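/- Let $n\ge 0$, let $h:\mathbb{R}^{n+1}\to\mathbb{R}$ be a homogeneous cubic polynomial, and call $p$ with $h(p)>0$ a hyperbolic point of $h$ if the negative Hessian $-\partial^2h_p$ has signature $(n,1)$. Assume that $h$ has at least one hyperbolic point. Let $\mathcal{H}$ be a relatively open subset of the level set $\{h=1\}$ that consists only of hyperbolic points of $h$; such an $\mathcal{H}$ is called an $n$-dimensional projective special real (PSR) manifold. It carries the Riemannian metric $g$ called its centro-affine fundamental form: for vector fields $X,Y$ tangent to $\mathcal{H}$, $g(X,Y)$ is the coefficient of the position vector field $\xi$ in the decomposition $\overline\nabla_XY=\nabla_XY+g(X,Y)\,\xi$, where $\overline\nabla$ is the flat connection of $\mathbb{R}^{n+1}$ and $\nabla_XY$ is tangent to $\mathcal{H}$. If $\mathcal{H}$ is closed as a subset of $\mathbb{R}^{n+1}$, then $(\mathcal{H},g)$ is geodesically complete, that is, for every $p\in\mathcal{H}$ and $v\in T_p\mathcal{H}$ the geodesic of the Levi-Civita connection of $g$ that starts at $p$ with velocity $v$ is defined on all of $\mathbb{R}$. -/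

import Mathlib

open scoped ContDiff Topology

noncomputable section

/-- The negative Hessian `-∂²f` at `p`, as a quadratic form on `ℝ^{n+1}`. -/
def negHessian {n : ℕ} (f : EuclideanSpace ℝ (Fin (n + 1)) → ℝ)
    (p : EuclideanSpace ℝ (Fin (n + 1))) :
    QuadraticForm ℝ (EuclideanSpace ℝ (Fin (n + 1))) :=
  LinearMap.BilinMap.toQuadraticMap
    (-(ContinuousLinearMap.toBilinForm (fderiv ℝ (fderiv ℝ f) p)))

/-- `p` is a hyperbolic point of `f` if `f p > 0` and `-∂²f` has signature `(n, 1)` at `p`. -/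
def IsHyperbolicPoint {n : ℕ} (f : EuclideanSpace ℝ (Fin (n + 1)) → ℝ)
    (p : EuclideanSpace ℝ (Fin (n + 1))) : Prop :=
  0 < f p ∧ sigPos (negHessian f p) = n ∧ sigNeg (negHessian f p) = 1

/-- The polynomial function on `ℝ^{n+1}` given by `h`. -/
def polyFun {n : ℕ} (h : MvPolynomial (Fin (n + 1)) ℝ)
    (p : EuclideanSpace ℝ (Fin (n + 1))) : ℝ :=
  MvPolynomial.eval (fun i => p i) h

/-- An `n`-dimensional projective special real (PSR) manifold in `ℝ^{n+1}`: a relatively open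
subset of the level set `{h = 1}` of a hyperbolic homogeneous cubic polynomial `h` that consists
only of hyperbolic points of `h`. -/
def IsPSRManifold {n : ℕ} (H : Set (EuclideanSpace ℝ (Fin (n + 1)))) : Prop :=
  ∃ h : MvPolynomial (Fin (n + 1)) ℝ,
    h.IsHomogeneous 3 ∧
    (∃ p, IsHyperbolicPoint (polyFun h) p) ∧
    (∃ W, IsOpen W ∧ H = W ∩ {p | polyFun h p = 1}) ∧
    ∀ p ∈ H, IsHyperbolicPoint (polyFun h) p

/-- A smooth immersion `φ` of the open set `V ⊆ ℝⁿ` into the hypersurface `H ⊆ ℝ^{n+1}`. As the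
dimensions of `V` and `H` agree, `φ` is a local diffeomorphism from `V` to `H`, i.e. a local
parametrization of `H` near each point of its image. -/
structure IsLocalParametrization {n : ℕ} (H : Set (EuclideanSpace ℝ (Fin (n + 1))))
    (V : Set (EuclideanSpace ℝ (Fin n)))
    (φ : EuclideanSpace ℝ (Fin n) → EuclideanSpace ℝ (Fin (n + 1))) : Prop where
  isOpen : IsOpen V
  smooth : ContDiffOn ℝ ∞ φ V
  immersion : ∀ x ∈ V, Function.Injective (fderiv ℝ φ x)
  mapsTo : Set.MapsTo φ V H

/-- The centro-affine fundamental form of the immersion `φ` in the coordinates of `ℝⁿ`. It is the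
coefficient `c` of the position vector in the Gauss equation
`D²φ_x(u, v) = dφ_x(∇_u v) + c • φ x`, for coordinate-constant vector fields `u` and `v`. -/
def centroAffineForm {n : ℕ}
    (φ : EuclideanSpace ℝ (Fin n) → EuclideanSpace ℝ (Fin (n + 1)))
    (x u v : EuclideanSpace ℝ (Fin n)) : ℝ :=
  Classical.epsilon fun c : ℝ =>
    ∃ w : EuclideanSpace ℝ (Fin n), fderiv ℝ (fderiv ℝ φ) x u v = fderiv ℝ φ x w + c • φ x

/-- The Gauss equation has a unique coefficient when the position vector is transversal. -/
theorem centroAffineForm_eq_iff {n : ℕ}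
    (φ : EuclideanSpace ℝ (Fin n) → EuclideanSpace ℝ (Fin (n + 1)))
    (x u v : EuclideanSpace ℝ (Fin n)) (hx : φ x ≠ 0)
    (htr : IsCompl (LinearMap.range (fderiv ℝ φ x).toLinearMap) (Submodule.span ℝ {φ x}))
    (c : ℝ) :
    centroAffineForm φ x u v = c ↔
      ∃ w : EuclideanSpace ℝ (Fin n),
        fderiv ℝ (fderiv ℝ φ) x u v = fderiv ℝ φ x w + c • φ x := by
  have hex : ∃ c : ℝ, ∃ w : EuclideanSpace ℝ (Fin n),
      fderiv ℝ (fderiv ℝ φ) x u v = fderiv ℝ φ x w + c • φ x := by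
    have hm : fderiv ℝ (fderiv ℝ φ) x u v ∈
        LinearMap.range (fderiv ℝ φ x).toLinearMap ⊔ Submodule.span ℝ {φ x} := by
      rw [htr.sup_eq_top]; trivial
    obtain ⟨y, ⟨w, rfl⟩, z, hz, hyz⟩ := Submodule.mem_sup.1 hm
    obtain ⟨c, rfl⟩ := Submodule.mem_span_singleton.1 hz
    exact ⟨c, w, hyz.symm⟩
  have huniq : ∀ c d : ℝ,
      (∃ w : EuclideanSpace ℝ (Fin n),
        fderiv ℝ (fderiv ℝ φ) x u v = fderiv ℝ φ x w + c • φ x) →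
      (∃ w : EuclideanSpace ℝ (Fin n),
        fderiv ℝ (fderiv ℝ φ) x u v = fderiv ℝ φ x w + d • φ x) → c = d := by
    rintro c d ⟨w, hw⟩ ⟨w', hw'⟩
    have hmem : (c - d) • φ x ∈ LinearMap.range (fderiv ℝ φ x).toLinearMap := by
      refine ⟨w' - w, ?_⟩
      have h2 := hw.symm.trans hw'
      simp only [ContinuousLinearMap.coe_coe, map_sub, sub_smul]
      exact sub_eq_sub_iff_add_eq_add.2 (by rw [← h2]; exact add_comm _ _)
    have h0 := (Submodule.disjoint_def.1 htr.disjoint) _ hmem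
      (Submodule.smul_mem _ _ (Submodule.mem_span_singleton_self _))
    rcases smul_eq_zero.1 h0 with h | h
    · exact sub_eq_zero.1 h
    · exact absurd h hx
  have hspec := Classical.epsilon_spec hex
  constructor
  · rintro rfl
    exact hspec
  · intro hc
    exact huniq _ _ hspec hc

/-- The Christoffel symbols of the first kind of a metric `g` on an open subset of `ℝⁿ`, that is
`g_x(∇_u v, w)` for the Levi-Civita connection `∇` and coordinate-constant fields `u`, `v`, `w`. -/
def christoffelFirst {n : ℕ}
    (g : EuclideanSpace ℝ (Fin n) → EuclideanSpace ℝ (Fin n) → EuclideanSpace ℝ (Fin n) → ℝ)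
    (x u v w : EuclideanSpace ℝ (Fin n)) : ℝ :=
  (fderiv ℝ (fun y => g y v w) x u + fderiv ℝ (fun y => g y u w) x v
    - fderiv ℝ (fun y => g y u v) x w) / 2

/-- `γ` is a geodesic, defined on all of `ℝ`, of `H` with its centro-affine fundamental form `g`:
near each time it is the image under a local parametrization of a smooth curve `x` that solves the
geodesic equation `g(∇_{x'} x', w) = g(x'', w) + Γ(x', x'; w) = 0` for all `w`, where `∇` is the
Levi-Civita connection of `g`. -/
def IsCentroAffineGeodesic {n : ℕ} (H : Set (EuclideanSpace ℝ (Fin (n + 1))))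
    (γ : ℝ → EuclideanSpace ℝ (Fin (n + 1))) : Prop :=
  ∀ t₀ : ℝ, ∃ (V : Set (EuclideanSpace ℝ (Fin n)))
    (φ : EuclideanSpace ℝ (Fin n) → EuclideanSpace ℝ (Fin (n + 1))),
    IsLocalParametrization H V φ ∧
    ∃ (ε : ℝ) (x : ℝ → EuclideanSpace ℝ (Fin n)), 0 < ε ∧
      ContDiffOn ℝ ∞ x (Set.Ioo (t₀ - ε) (t₀ + ε)) ∧
      ∀ t ∈ Set.Ioo (t₀ - ε) (t₀ + ε),
        x t ∈ V ∧ γ t = φ (x t) ∧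
        ∀ w : EuclideanSpace ℝ (Fin n),
          centroAffineForm φ (x t) (deriv (deriv x) t) w
            + christoffelFirst (centroAffineForm φ) (x t) (deriv x t) (deriv x t) w = 0

/-- `v` is tangent to `H` at `p`: it is the velocity at `p` of a curve in `H`. -/
def IsTangentTo {n : ℕ} (H : Set (EuclideanSpace ℝ (Fin (n + 1))))
    (p v : EuclideanSpace ℝ (Fin (n + 1))) : Prop :=
  ∃ c : ℝ → EuclideanSpace ℝ (Fin (n + 1)),
    c 0 = p ∧ HasDerivAt c v 0 ∧ ∀ᶠ t in 𝓝 (0 : ℝ), c t ∈ H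

/-- The hypersurface `H` with its centro-affine fundamental form is geodesically complete: for
each point `p` of `H` and each tangent vector `v` at `p`, the geodesic that starts at `p` with
velocity `v` is defined on all of `ℝ`. -/
def IsGeodesicallyComplete {n : ℕ} (H : Set (EuclideanSpace ℝ (Fin (n + 1)))) : Prop :=
  ∀ p ∈ H, ∀ v, IsTangentTo H p v →
    ∃ γ : ℝ → EuclideanSpace ℝ (Fin (n + 1)),
      IsCentroAffineGeodesic H γ ∧ γ 0 = p ∧ HasDerivAt γ v 0

end

/-! Write the cubic as h(x) = T(x,x,x) with T symmetric trilinear. On H the centro-affine metric is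
g(u,v) = -2T(x,u,v), so a curve x in H is a geodesic exactly when T(x,x'',w) + ½T(x',x',w) = 0 for
all tangent w. This is the restriction of an ODE on an open set of pairs (x,v), `cubicSpray`. A
solution extends to all times if it stays in a compact part of that set over bounded times; as H is
closed, a bound on the Euclidean speed is enough (`IsClosedHyperbolic.exists_compact`).

Closedness enters through T(v,v,v)² ≤ 4(-T(q,v,v))³ for tangent v
(`IsClosedHyperbolic.sq_cubic_le`). If this fails, with T(v,v,v) > 0 say, then h is positive on the
whole ray q + tv, t ≥ 0. The radial projection of the ray to {h = 1} cannot leave the closed and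
relatively open H, yet one of its points violates the reverse Cauchy–Schwarz inequality of
hyperbolic points. Polarization then bounds T(v,u,u) by the metric.

Consequently the positive definite form -T(q,e,e) + 2T(q,q,e)² on the ambient space, for fixed e,
has logarithmic derivative at most 9√(-T(q,v,v)) in a tangent direction v
(`IsClosedHyperbolic.abs_deriv_ambientMetric_le`). Along a geodesic -T(x,x',x') is constant, so the
forms at times 0 and t compare up to an exponential factor. Taking e = x'(t) bounds x'(t) in the
fixed form at time 0. -/

/-! ### Extension of solutions of autonomous ODEs -/

section ODE
open Set

variable {F : Type*} [NormedAddCommGroup F] [NormedSpace ℝ F]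

/-- `x` solves `x' = X x` on `[0, b]` and stays in `O` there. -/
def IsForwardSolution (X : F → F) (O : Set F) (x : ℝ → F) (b : ℝ) : Prop :=
  ∀ t ∈ Icc 0 b, x t ∈ O ∧ HasDerivWithinAt x (X (x t)) (Icc 0 b) t

variable {X : F → F} {O : Set F}

theorem IsForwardSolution.mono {x : ℝ → F} {a b : ℝ} (hx : IsForwardSolution X O x b)
    (hab : a ≤ b) : IsForwardSolution X O x a := fun t ht =>
  have hs : Icc 0 a ⊆ Icc 0 b := Icc_subset_Icc_right hab
  ⟨(hx t (hs ht)).1, (hx t (hs ht)).2.mono hs⟩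

theorem IsForwardSolution.congr {x y : ℝ → F} {b : ℝ} (hx : IsForwardSolution X O x b)
    (h : EqOn y x (Icc 0 b)) : IsForwardSolution X O y b := fun t ht => by
  rw [h ht]
  exact ⟨(hx t ht).1, (hx t ht).2.congr h (h ht)⟩

theorem IsForwardSolution.continuousOn {x : ℝ → F} {b : ℝ} (hx : IsForwardSolution X O x b) :
    ContinuousOn x (Icc 0 b) := fun t ht => (hx t ht).2.continuousWithinAt

/-- Concatenation of two solutions of an autonomous equation. -/
theorem IsForwardSolution.append {x y : ℝ → F} {b c : ℝ} (hb : 0 ≤ b) (hc : 0 ≤ c)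
    (hx : IsForwardSolution X O x b) (hy : IsForwardSolution X O y c) (hxy : y 0 = x b) :
    IsForwardSolution X O (fun t => if t ≤ b then x t else y (t - b)) (b + c) := by
  set z : ℝ → F := fun t => if t ≤ b then x t else y (t - b) with hz
  have hz1 : EqOn z x (Icc 0 b) := fun t ht => by simp [hz, ht.2]
  have hz2 : EqOn z (fun t => y (t - b)) (Icc b (b + c)) := fun t ht => by
    rcases eq_or_lt_of_le ht.1 with h | h
    · subst h; simp [hz, hxy]
    · simp [hz, not_le.2 h]
  have hu : Icc 0 (b + c) = Icc 0 b ∪ Icc b (b + c) :=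
    (Icc_union_Icc_eq_Icc hb (by linarith)).symm
  have h1 : ∀ t ∈ Icc 0 b, HasDerivWithinAt z (X (z t)) (Icc 0 b) t := fun t ht => by
    rw [hz1 ht]; exact (hx t ht).2.congr hz1 (hz1 ht)
  have h2 : ∀ t ∈ Icc b (b + c), HasDerivWithinAt z (X (z t)) (Icc b (b + c)) t := fun t ht => by
    have ht' : t - b ∈ Icc 0 c := ⟨by linarith [ht.1], by linarith [ht.2]⟩
    have hd := (hy (t - b) ht').2.scomp t (s := Icc b (b + c)) (h := fun s => s - b)
      (((hasDerivAt_id t).sub_const b).hasDerivWithinAt)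
      (fun s hs => ⟨by linarith [hs.1], by linarith [hs.2]⟩)
    rw [hz2 ht]
    simpa using hd.congr hz2 (hz2 ht)
  intro t ht
  refine ⟨?_, ?_⟩
  · rcases le_total t b with h | h
    · rw [hz1 ⟨ht.1, h⟩]; exact (hx t ⟨ht.1, h⟩).1
    · rw [hz2 ⟨h, ht.2⟩]
      exact (hy (t - b) ⟨by linarith, by linarith [ht.2]⟩).1
  · rcases lt_trichotomy t b with h | h | h
    · refine (h1 t ⟨ht.1, h.le⟩).mono_of_mem_nhdsWithin ?_
      filter_upwards [self_mem_nhdsWithin, mem_nhdsWithin_of_mem_nhds (Iio_mem_nhds h)] with s hs hs'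
      exact ⟨hs.1, le_of_lt hs'⟩
    · rw [hu]
      exact (h1 t ⟨ht.1, h.le⟩).union (h2 t ⟨h.ge, ht.2⟩)
    · refine (h2 t ⟨h.le, ht.2⟩).mono_of_mem_nhdsWithin ?_
      filter_upwards [self_mem_nhdsWithin, mem_nhdsWithin_of_mem_nhds (Ioi_mem_nhds h)] with s hs hs'
      exact ⟨le_of_lt hs', hs.2⟩

variable [CompleteSpace F]

/-- The Picard–Lindelöf flow is jointly continuous in the initial value and time, so it remains in
the open set `O` on a product neighbourhood. This gives one lifetime for all nearby initial values.
-/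
theorem exists_isForwardSolution_nhds (hO : IsOpen O) (hX : ContDiffOn ℝ 1 X O) {x₀ : F}
    (hx₀ : x₀ ∈ O) :
    ∃ U ∈ 𝓝 x₀, ∃ ε > 0, ∀ y ∈ U, ∃ x : ℝ → F, x 0 = y ∧ IsForwardSolution X O x ε := by
  obtain ⟨ε, hε, a, r, L, K, hr, hP⟩ :=
    IsPicardLindelof.of_contDiffAt_one (hX.contDiffAt (hO.mem_nhds hx₀))
  obtain ⟨α, hα, hαc⟩ := (hP 0).exists_forall_mem_closedBall_eq_hasDerivWithinAt_continuousOn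
  simp only [zero_sub, zero_add] at hα hαc
  have hr' : (0 : ℝ) < r := hr
  have hnb : Metric.closedBall x₀ r ×ˢ Icc (-ε) ε ∈ 𝓝 (x₀, (0 : ℝ)) :=
    prod_mem_nhds (Metric.closedBall_mem_nhds x₀ hr') (Icc_mem_nhds (by linarith) hε)
  have hα0 : α (x₀, 0) = x₀ := (hα x₀ (Metric.mem_closedBall_self hr'.le)).1
  have hOα : α ⁻¹' O ∈ 𝓝 (x₀, (0 : ℝ)) :=
    (hαc.continuousAt hnb).preimage_mem_nhds (by rw [hα0]; exact hO.mem_nhds hx₀)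
  obtain ⟨U, hU, T, hT, hUT⟩ := mem_nhds_prod_iff.1 (Filter.inter_mem hnb hOα)
  obtain ⟨δ, hδ, hδT⟩ := Metric.mem_nhds_iff.1 hT
  have hsub : ∀ t ∈ Icc 0 (δ / 2), t ∈ T := fun t ht => hδT (by
    rw [Metric.mem_ball, Real.dist_eq, sub_zero, abs_of_nonneg ht.1]; linarith [ht.2])
  refine ⟨U, hU, δ / 2, half_pos hδ, fun y hy => ⟨fun t => α (y, t), ?_, fun t ht => ?_⟩⟩
  · exact (hα y (hUT (mk_mem_prod hy (mem_of_mem_nhds hT))).1.1).1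
  · have h := hUT (mk_mem_prod hy (hsub t ht))
    exact ⟨h.2, ((hα y h.1.1).2 t h.1.2).mono fun s hs => (hUT (mk_mem_prod hy (hsub s hs))).1.2⟩

theorem IsCompact.exists_isForwardSolution (hO : IsOpen O) (hX : ContDiffOn ℝ 1 X O) {K : Set F}
    (hK : IsCompact K) (hKO : K ⊆ O) :
    ∃ ε > 0, ∀ y ∈ K, ∃ x : ℝ → F, x 0 = y ∧ IsForwardSolution X O x ε := by
  refine hK.induction_on (p := fun K => ∃ ε > 0, ∀ y ∈ K, ∃ x : ℝ → F, x 0 = y ∧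
    IsForwardSolution X O x ε) ⟨1, one_pos, by simp⟩ ?_ ?_ ?_
  · rintro s t hst ⟨ε, hε, h⟩
    exact ⟨ε, hε, fun y hy => h y (hst hy)⟩
  · rintro s t ⟨ε, hε, h⟩ ⟨δ, hδ, h'⟩
    refine ⟨min ε δ, lt_min hε hδ, fun y hy => ?_⟩
    rcases hy with hy | hy
    · obtain ⟨x, hx0, hx⟩ := h y hy
      exact ⟨x, hx0, hx.mono (min_le_left _ _)⟩
    · obtain ⟨x, hx0, hx⟩ := h' y hy
      exact ⟨x, hx0, hx.mono (min_le_right _ _)⟩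
  · intro x hx
    obtain ⟨U, hU, h⟩ := exists_isForwardSolution_nhds hO hX (hKO hx)
    exact ⟨U, mem_nhdsWithin_of_mem_nhds hU, h⟩

/-- A solution that has to stay in a compact set over each bounded time interval can be extended to
all positive times. -/
theorem exists_global_isForwardSolution (hO : IsOpen O) (hX : ContDiffOn ℝ 1 X O) {x₀ : F}
    (hx₀ : x₀ ∈ O)
    (hK : ∀ T : ℝ, ∃ K : Set F, IsCompact K ∧ K ⊆ O ∧ ∀ (x : ℝ → F) (b : ℝ), 0 ≤ b → b ≤ T →
      x 0 = x₀ → IsForwardSolution X O x b → x b ∈ K) :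
    ∃ x : ℝ → F, x 0 = x₀ ∧ ∀ b, IsForwardSolution X O x b := by
  have key : ∀ (T b : ℝ) (x : ℝ → F), 0 ≤ b → b ≤ T → x 0 = x₀ → IsForwardSolution X O x b →
      ∃ y, IsForwardSolution X O y T ∧ EqOn y x (Icc 0 b) := by
    intro T b x hb hbT hx0 hx
    obtain ⟨K, hKc, hKO, hKx⟩ := hK T
    obtain ⟨ε, hε, hloc⟩ := hKc.exists_isForwardSolution hO hX hKO
    -- The endpoint reached always lies in `K`, so each prolongation gains the same time `ε`, and
    -- finitely many reach `T`.
    have hstep : ∀ k : ℕ, ∃ y, IsForwardSolution X O y (min (b + k * ε) T) ∧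
        EqOn y x (Icc 0 b) := by
      intro k
      induction k with
      | zero => exact ⟨x, by simpa [hbT] using hx, fun _ _ => rfl⟩
      | succ k ih =>
        obtain ⟨y, hy, hyx⟩ := ih
        set c := min (b + k * ε) T with hc
        have hbc : b ≤ c := le_min (le_add_of_nonneg_right (by positivity)) hbT
        have hy0 : y 0 = x₀ := by rw [hyx ⟨le_rfl, hb⟩, hx0]
        obtain ⟨z, hz0, hz⟩ := hloc _ (hKx y c (hb.trans hbc) (min_le_right _ _) hy0 hy)
        refine ⟨_, (hy.append (hb.trans hbc) hε.le hz hz0).mono ?_, fun t ht => ?_⟩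
        · rw [hc]
          push_cast
          rcases le_total (b + k * ε) T with h | h
          · rw [min_eq_left h]
            exact (min_le_left _ _).trans (by linarith)
          · rw [min_eq_right h]
            exact (min_le_right _ _).trans (by linarith)
        · simp only [if_pos (ht.2.trans hbc)]
          exact hyx ht
    obtain ⟨k, hk⟩ := exists_nat_gt ((T - b) / ε)
    obtain ⟨y, hy, hyx⟩ := hstep k
    rw [div_lt_iff₀ hε] at hk
    rw [min_eq_right (by linarith)] at hy
    exact ⟨y, hy, hyx⟩
  let S := fun n : ℕ => {x : ℝ → F // x 0 = x₀ ∧ IsForwardSolution X O x n}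
  have hnext : ∀ (n : ℕ) (x : S n), ∃ y : S (n + 1), EqOn y.1 x.1 (Icc 0 n) := by
    rintro n ⟨x, hx0, hx⟩
    obtain ⟨y, hy, hyx⟩ := key (n + 1 : ℕ) n x (by positivity) (by simp) hx0 hx
    exact ⟨⟨y, by rw [hyx ⟨le_rfl, by positivity⟩, hx0], hy⟩, hyx⟩
  choose next hnext using hnext
  have h0 : IsForwardSolution X O (fun _ => x₀) ((0 : ℕ) : ℝ) := fun t ht => by
    refine ⟨hx₀, ?_⟩
    simp only [Nat.cast_zero, Icc_self] at ht ⊢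
    rw [mem_singleton_iff.1 ht]
    exact HasFDerivWithinAt.of_subsingleton subsingleton_singleton
  -- Each solution on [0, n + 1] is chosen as an extension of the one on [0, n], so they can be
  -- glued without appeal to uniqueness.
  let u : (n : ℕ) → S n := fun n => Nat.rec ⟨_, rfl, h0⟩ next n
  have hu : ∀ m n : ℕ, n ≤ m → EqOn (u m).1 (u n).1 (Icc 0 n) := by
    intro m n hnm
    induction m, hnm using Nat.le_induction with
    | base => exact fun _ _ => rfl
    | succ m hnm ih =>
      intro t ht
      have hm : (n : ℝ) ≤ m := by exact_mod_cast hnm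
      exact (hnext m (u m) ⟨ht.1, ht.2.trans hm⟩).trans (ih ht)
  refine ⟨fun t => (u ⌈t⌉₊).1 t, (u _).2.1, fun b => ?_⟩
  obtain ⟨n, hn⟩ := exists_nat_ge b
  refine IsForwardSolution.mono ?_ hn
  refine (u n).2.2.congr fun t ht => ?_
  exact (hu n ⌈t⌉₊ (Nat.ceil_le.2 ht.2) ⟨ht.1, Nat.le_ceil t⟩).symm

-- Bootstrapping: z' = X ∘ z is as smooth as z, so z gains one derivative at a time.
omit [CompleteSpace F] in
theorem contDiff_of_hasDerivAt (hX : ContDiffOn ℝ ∞ X O) {z : ℝ → F}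
    (hz : ∀ t, z t ∈ O ∧ HasDerivAt z (X (z t)) t) : ContDiff ℝ ∞ z := by
  refine contDiff_infty.2 fun n => ?_
  have hd : deriv z = X ∘ z := funext fun t => (hz t).2.deriv
  induction n with
  | zero =>
    exact contDiff_zero.2 (continuous_iff_continuousAt.2 fun t => (hz t).2.continuousAt)
  | succ n ih =>
    push_cast
    refine contDiff_succ_iff_deriv.2 ⟨fun t => (hz t).2.differentiableAt, by simp, ?_⟩
    rw [hd]
    exact (hX.of_le (by exact_mod_cast le_top)).comp_contDiff ih fun t => (hz t).1

omit [CompleteSpace F] in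
/-- Two forward solutions of a reversible equation with opposite initial values form a solution on
the whole line. -/
theorem exists_solution_of_reversible (R : F →L[ℝ] F)
    (hRO : ∀ z ∈ O, R z ∈ O) (hRX : ∀ z, X (R z) = -R (X z)) {x y : ℝ → F}
    (hx : ∀ b, IsForwardSolution X O x b) (hy : ∀ b, IsForwardSolution X O y b)
    (hxy : x 0 = R (y 0)) :
    ∃ z : ℝ → F, (∀ t, 0 ≤ t → z t = x t) ∧ (∀ t, 0 ≤ t → z (-t) = R (y t)) ∧
      ∀ t, z t ∈ O ∧ HasDerivAt z (X (z t)) t := by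
  set z : ℝ → F := fun t => if 0 ≤ t then x t else R (y (-t)) with hz
  have h1 : ∀ t, 0 ≤ t → z t = x t := fun t ht => if_pos ht
  have h2 : ∀ t, 0 ≤ t → z (-t) = R (y t) := fun t ht => by
    rcases eq_or_lt_of_le ht with h | h
    · rw [← h, neg_zero, h1 0 le_rfl, hxy]
    · simp [hz, h]
  have h3 : ∀ b : ℝ, ∀ t ∈ Icc 0 b, HasDerivWithinAt z (X (z t)) (Icc 0 b) t := fun b t ht => by
    rw [h1 t ht.1]
    exact (hx b t ht).2.congr (fun s hs => h1 s hs.1) (h1 t ht.1)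
  have h4 : ∀ b : ℝ, ∀ t ∈ Icc (-b) 0, HasDerivWithinAt z (X (z t)) (Icc (-b) 0) t := by
    intro b t ht
    have e : ∀ s ∈ Icc (-b) 0, z s = R (y (-s)) := fun s hs => by
      rw [← h2 (-s) (neg_nonneg.2 hs.2), neg_neg]
    have hd := (hy b (-t) ⟨neg_nonneg.2 ht.2, by linarith [ht.1]⟩).2.scomp t (s := Icc (-b) 0)
      (h := fun s => -s) ((hasDerivAt_neg t).hasDerivWithinAt)
      (fun s hs => ⟨neg_nonneg.2 hs.2, by linarith [hs.1]⟩)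
    have hd' := R.hasFDerivAt.comp_hasDerivWithinAt t hd
    rw [e t ht, hRX]
    refine (hd'.congr e (e t ht)).congr_deriv ?_
    simp
  refine ⟨z, h1, h2, fun t => ⟨?_, ?_⟩⟩
  · rcases le_total 0 t with h | h
    · rw [h1 t h]; exact (hx t t ⟨h, le_rfl⟩).1
    · rw [← neg_neg t, h2 (-t) (neg_nonneg.2 h)]
      exact hRO _ (hy (-t) (-t) ⟨neg_nonneg.2 h, le_rfl⟩).1
  · rcases lt_trichotomy t 0 with h | h | h
    · exact (h4 (-(t - 1)) t ⟨by linarith, h.le⟩).hasDerivAt (Icc_mem_nhds (by linarith) h)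
    · subst h
      refine ((h4 1 0 (by simp)).union (h3 1 0 (by simp))).hasDerivAt ?_
      rw [Icc_union_Icc_eq_Icc (by norm_num) (by norm_num)]
      exact Icc_mem_nhds (by norm_num) (by norm_num)
    · exact (h3 (t + 1) t ⟨h.le, by linarith⟩).hasDerivAt (Icc_mem_nhds h (by linarith))

end ODE

/-! ### Estimates for a cubic form at hyperbolic points -/

section Cubic
open Set

variable {E : Type*} [NormedAddCommGroup E] [NormedSpace ℝ E]

/-- Symmetry of a trilinear form. -/
structure IsSymmTrilinear (T : E →L[ℝ] E →L[ℝ] E →L[ℝ] ℝ) : Prop where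
  swap_left : ∀ u v w, T u v w = T v u w
  swap_right : ∀ u v w, T u v w = T u w v

/-- `p` is a hyperbolic point of the cubic form `x ↦ T x x x`. -/
def IsHyperbolicFor (T : E →L[ℝ] E →L[ℝ] E →L[ℝ] ℝ) (p : E) : Prop :=
  0 < T p p p ∧ ∀ v, v ≠ 0 → T p p v = 0 → T p v v < 0

/-- `H` is a closed and relatively open subset of the level set of `x ↦ T x x x` at level `1` that
consists only of hyperbolic points. -/
structure IsClosedHyperbolic (T : E →L[ℝ] E →L[ℝ] E →L[ℝ] ℝ) (H : Set E) : Prop where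
  symm : IsSymmTrilinear T
  isClosed : IsClosed H
  exists_isOpen : ∃ W, IsOpen W ∧ H = W ∩ {x | T x x x = 1}
  hyperbolic : ∀ q ∈ H, IsHyperbolicFor T q

variable {T : E →L[ℝ] E →L[ℝ] E →L[ℝ] ℝ} {H : Set E}

theorem IsClosedHyperbolic.apply_eq_one (hH : IsClosedHyperbolic T H) {q : E} (hq : q ∈ H) :
    T q q q = 1 := by
  obtain ⟨W, -, hW⟩ := hH.exists_isOpen
  rw [hW] at hq
  exact hq.2

theorem IsHyperbolicFor.neg_apply_nonneg {p v : E} (hp : IsHyperbolicFor T p) (hv : T p p v = 0) :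
    0 ≤ -T p v v := by
  rcases eq_or_ne v 0 with rfl | h
  · simp
  · exact (neg_pos.2 (hp.2 v h hv)).le

/-- The reverse Cauchy–Schwarz inequality of a Lorentzian form. -/
theorem IsHyperbolicFor.mul_le_sq (hT : IsSymmTrilinear T) {p : E} (hp : IsHyperbolicFor T p)
    (v : E) : T p p p * T p v v ≤ T p p v ^ 2 := by
  have h0 := hp.1
  -- The tangential part of `v` along `p`, multiplied by T(p,p,p) to avoid division.
  have h := hp.neg_apply_nonneg (v := T p p p • v - T p p v • p) (by simp; ring)
  simp only [map_sub, map_smul, sub_apply, smul_apply,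
    smul_eq_mul, hT.swap_right p v p] at h
  have h2 : 0 ≤ T p p p * (T p p v ^ 2 - T p p p * T p v v) := by nlinarith
  linarith [nonneg_of_mul_nonneg_right h2 h0]

/-- A path in the level set does not leave `H`. -/
theorem IsClosedHyperbolic.mem_of_path (hH : IsClosedHyperbolic T H) {c : ℝ → E} {b : ℝ}
    (hc : ContinuousOn c (Icc 0 b)) (h1 : ∀ t ∈ Icc 0 b, T (c t) (c t) (c t) = 1)
    (h0 : c 0 ∈ H) {t : ℝ} (ht : t ∈ Icc 0 b) : c t ∈ H := by
  obtain ⟨W, hWo, hW⟩ := hH.exists_isOpen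
  by_contra hn
  have hs : IsPreconnected (c '' Icc 0 b) := isPreconnected_Icc.image c hc
  -- Along the path, membership in `H` is the open condition `W`; as `H` is also closed,
  -- connectedness of the path decides.
  have hmem : ∀ x ∈ c '' Icc 0 b, x ∈ H ↔ x ∈ W := by
    rintro _ ⟨s, hs, rfl⟩
    rw [hW]
    exact ⟨fun h => h.1, fun h => ⟨h, h1 s hs⟩⟩
  have h00 : c 0 ∈ c '' Icc 0 b := mem_image_of_mem c ⟨le_rfl, ht.1.trans ht.2⟩
  obtain ⟨x, hx, hxW, hxH⟩ := hs W Hᶜ hWo hH.isClosed.isOpen_compl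
    (fun x hx => (em (x ∈ H)).imp (hmem x hx).1 id)
    ⟨c 0, h00, (hmem _ h00).1 h0⟩ ⟨c t, mem_image_of_mem c ht, hn⟩
  exact hxH ((hmem x hx).2 hxW)

/-- Closedness bounds the cubic form on the tangent space by the second fundamental form. -/
theorem IsClosedHyperbolic.sq_cubic_le (hH : IsClosedHyperbolic T H) {q v : E} (hq : q ∈ H)
    (hv : T q q v = 0) : T v v v ^ 2 ≤ 4 * (-T q v v) ^ 3 := by
  have hT := hH.symm
  have hq1 := hH.apply_eq_one hq
  wlog hc : 0 < T v v v generalizing v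
  · rcases eq_or_lt_of_le (not_lt.1 hc) with h | h
    · have := pow_nonneg ((hH.hyperbolic q hq).neg_apply_nonneg hv) 3
      rw [h]; simp only [ne_eq, OfNat.ofNat_ne_zero, not_false_eq_true, zero_pow]; positivity
    · simpa using this (v := -v) (by simpa using hv) (by simpa using h)
  by_contra hlt
  rw [not_le] at hlt
  have hA : 0 < -T q v v := neg_pos.2 ((hH.hyperbolic q hq).2 v
    (by rintro rfl; simp at hc) hv)
  set A := -T q v v with hAdef
  set c := T v v v with hcdef
  have hqvv : T q v v = -A := by rw [hAdef, neg_neg]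
  have e1 : T v q q = 0 := by rw [hT.swap_left, hT.swap_right, hv]
  have e2 : T q v q = 0 := by rw [hT.swap_right, hv]
  have e3 : T v q v = -A := by rw [hT.swap_left, hqvv]
  have e4 : T v v q = -A := by rw [hT.swap_right, e3]
  have hf : ∀ t : ℝ, T (q + t • v) (q + t • v) (q + t • v) = 1 - 3 * t ^ 2 * A + t ^ 3 * c := by
    intro t
    simp only [map_add, map_smul, add_apply, smul_apply, smul_eq_mul, hq1, hv,
      e1, e2, e3, e4, hqvv, ← hcdef]
    ring
  have hfpos : ∀ t : ℝ, 0 ≤ t → 0 < 1 - 3 * t ^ 2 * A + t ^ 3 * c := by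
    intro t ht
    -- c²(1 - 3At² + ct³) = (tc - 2A)²(tc + A) + (c² - 4A³), and the last bracket is positive by
    -- assumption.
    have h1 : 0 ≤ (t * c - 2 * A) ^ 2 * (t * c + A) := by positivity
    have h2 : 0 < c ^ 2 * (1 - 3 * t ^ 2 * A + t ^ 3 * c) := by nlinarith
    exact pos_of_mul_pos_right h2 (by positivity)
  -- At q + tv the reverse Cauchy–Schwarz inequality reduces to 0 ≤ A - tc + t²A². This quadratic
  -- has discriminant c² - 4A³ > 0, and `b` is its minimum.
  set b := c / (2 * A ^ 2) with hb
  have hb0 : 0 ≤ b := by positivity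
  set f : ℝ → ℝ := fun t => 1 - 3 * t ^ 2 * A + t ^ 3 * c with hfdef
  set r : ℝ → ℝ := fun t => (f t) ^ (-(1 / 3) : ℝ) with hr
  have hr3 : ∀ t, 0 ≤ t → r t ^ 3 * f t = 1 := by
    intro t ht
    rw [hr]
    simp only
    rw [← Real.rpow_natCast, ← Real.rpow_mul (hfpos t ht).le]
    norm_num
    rw [Real.rpow_neg_one, inv_mul_cancel₀ (hfpos t ht).ne']
  have hmem : r b • (q + b • v) ∈ H := by
    refine hH.mem_of_path (c := fun t => r t • (q + t • v)) (b := b) ?_ ?_ ?_ ⟨hb0, le_rfl⟩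
    · refine ContinuousOn.smul (ContinuousOn.rpow_const (by fun_prop) fun t ht => ?_) (by fun_prop)
      exact Or.inl (hfpos t ht.1).ne'
    · intro t ht
      have := hr3 t ht.1
      simp only [map_smul, smul_apply, smul_eq_mul, hf]
      linear_combination this
    · simpa [hr, hfdef] using hq
  have hcs := (hH.hyperbolic _ hmem).mul_le_sq hT v
  have hrb : 0 < r b := Real.rpow_pos_of_pos (hfpos b hb0) _
  simp only [map_add, map_smul, add_apply, smul_apply, smul_eq_mul, hq1, hv,
      e1, e2, e3, e4, hqvv, ← hcdef] at hcs
  have hneg : 0 ≤ r b ^ 4 * (A - b * c + b ^ 2 * A ^ 2) := by nlinarith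
  have hneg2 := nonneg_of_mul_nonneg_right hneg (by positivity)
  have : A - b * c + b ^ 2 * A ^ 2 = (4 * A ^ 3 - c ^ 2) / (4 * A ^ 2) := by
    rw [hb]; field_simp; ring
  rw [this] at hneg2
  have := div_neg_of_neg_of_pos (sub_neg.2 hlt) (show 0 < 4 * A ^ 2 by positivity)
  linarith

/-- Polarization: 6T(v,u,u) is the sum of the cubes of v ± u minus twice the cube of v. The vectors
v ± u have squared length at most 4, so their cubes are at most 16, and 6 = (16 + 16 + 2·2)/6. -/
theorem IsClosedHyperbolic.abs_cubic_le_of_eq_one (hH : IsClosedHyperbolic T H) {q u v : E}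
    (hq : q ∈ H) (hu : T q q u = 0) (hv : T q q v = 0) (hu1 : -T q u u = 1) (hv1 : -T q v v = 1) :
    |T q v u| ≤ 1 ∧ |T v u u| ≤ 6 := by
  have hT := hH.symm
  have hyp := hH.hyperbolic q hq
  have hp : T q q (v + u) = 0 := by simp [hu, hv]
  have hm : T q q (v - u) = 0 := by simp [hu, hv]
  have hp' := hyp.neg_apply_nonneg hp
  have hm' := hyp.neg_apply_nonneg hm
  have cp := hH.sq_cubic_le hq hp
  have cm := hH.sq_cubic_le hq hm
  have cv := hH.sq_cubic_le hq hv
  have ep : -T q (v + u) (v + u) = 2 - 2 * T q v u := by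
    simp only [map_add, add_apply, hT.swap_right q u v]; linarith
  have em : -T q (v - u) (v - u) = 2 + 2 * T q v u := by
    simp only [map_sub, sub_apply, hT.swap_right q u v]; linarith
  rw [ep] at hp' cp
  rw [em] at hm' cm
  have habs : |T q v u| ≤ 1 := abs_le.2 ⟨by linarith, by linarith⟩
  refine ⟨habs, ?_⟩
  have h16 : ∀ x y : ℝ, 0 ≤ y → y ≤ 4 → x ^ 2 ≤ 4 * y ^ 3 → |x| ≤ 16 := by
    intro x y hy hy4 h
    have : y ^ 3 ≤ 4 ^ 3 := pow_le_pow_left₀ hy hy4 3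
    exact abs_le_of_sq_le_sq (by linarith) (by norm_num)
  have hp16 := h16 _ _ hp' (by linarith [(abs_le.1 habs).1]) cp
  have hm16 := h16 _ _ hm' (by linarith [(abs_le.1 habs).2]) cm
  rw [hv1] at cv
  have hv2 : |T v v v| ≤ 2 := abs_le_of_sq_le_sq (by linarith) (by norm_num)
  have key : 6 * T v u u = T (v + u) (v + u) (v + u) + T (v - u) (v - u) (v - u) - 2 * T v v v := by
    have e1 : T u v u = T v u u := hT.swap_left _ _ _
    have e2 : T u u v = T v u u := by rw [hT.swap_right, e1]
    simp only [map_add, map_sub, add_apply, sub_apply, e1, e2]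
    ring
  rw [abs_le] at hp16 hm16 hv2 ⊢
  constructor <;> linarith [hp16.1, hm16.1, hv2.1, hp16.2, hm16.2, hv2.2]

theorem IsClosedHyperbolic.abs_cubic_le (hH : IsClosedHyperbolic T H) {q u v : E}
    (hq : q ∈ H) (hu : T q q u = 0) (hv : T q q v = 0) :
    |T q v u| ≤ √(-T q v v) * √(-T q u u) ∧ |T v u u| ≤ 6 * √(-T q v v) * (-T q u u) := by
  have hyp := hH.hyperbolic q hq
  rcases eq_or_ne u 0 with rfl | hu0
  · simp
  rcases eq_or_ne v 0 with rfl | hv0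
  · simp
  have hA : 0 < -T q u u := neg_pos.2 (hyp.2 u hu0 hu)
  have hB : 0 < -T q v v := neg_pos.2 (hyp.2 v hv0 hv)
  obtain ⟨a, ha, hau⟩ : ∃ a : ℝ, 0 < a ∧ -T q u u = a ^ 2 :=
    ⟨_, Real.sqrt_pos.2 hA, (Real.sq_sqrt hA.le).symm⟩
  obtain ⟨b, hb, hbv⟩ : ∃ b : ℝ, 0 < b ∧ -T q v v = b ^ 2 :=
    ⟨_, Real.sqrt_pos.2 hB, (Real.sq_sqrt hB.le).symm⟩
  rw [hau, hbv, Real.sqrt_sq ha.le, Real.sqrt_sq hb.le]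
  have h := hH.abs_cubic_le_of_eq_one (u := a⁻¹ • u) (v := b⁻¹ • v) hq (by simp [hu]) (by simp [hv])
    (by simp only [map_smul, smul_apply, smul_eq_mul]
        rw [show -(a⁻¹ * (a⁻¹ * T q u u)) = a⁻¹ * a⁻¹ * (-T q u u) by ring, hau]; field_simp)
    (by simp only [map_smul, smul_apply, smul_eq_mul]
        rw [show -(b⁻¹ * (b⁻¹ * T q v v)) = b⁻¹ * b⁻¹ * (-T q v v) by ring, hbv]; field_simp)
  simp only [map_smul, smul_apply, smul_eq_mul, abs_mul, abs_inv,
    abs_of_pos ha, abs_of_pos hb] at h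
  obtain ⟨h1, h2⟩ := h
  constructor
  · have := mul_le_mul_of_nonneg_left h1 (mul_pos hb ha).le
    field_simp at this
    linarith
  · have := mul_le_mul_of_nonneg_left h2 (mul_pos hb (pow_pos ha 2)).le
    field_simp at this
    linarith

/-- A positive definite form on the whole space that agrees with `-T q` on the tangent space. -/
noncomputable def ambientMetric (T : E →L[ℝ] E →L[ℝ] E →L[ℝ] ℝ) (q e : E) : ℝ :=
  -T q e e + 2 * T q q e ^ 2

/-- For tangent e this is hyperbolicity. Otherwise reverse Cauchy–Schwarz gives -T(q,e,e) ≥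
-T(q,q,e)², and the factor 2 leaves a positive remainder. -/
theorem IsHyperbolicFor.ambientMetric_pos (hT : IsSymmTrilinear T) {q : E}
    (hq : IsHyperbolicFor T q) (hq1 : T q q q = 1) {e : E} (he : e ≠ 0) :
    0 < ambientMetric T q e := by
  unfold ambientMetric
  rcases eq_or_ne (T q q e) 0 with h | h
  · have := hq.2 e he h
    rw [h]; linarith
  · have := hq.mul_le_sq hT e
    rw [hq1] at this
    have : 0 < T q q e ^ 2 := by positivity
    linarith

/-- The left side is the derivative of `ambientMetric T q e` in q along v. With e = αq + u it equals
6αT(q,v,u) - T(v,u,u), while the form itself is α² - T(q,u,u); the constant is 9 = 6/2 + 6. -/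
theorem IsClosedHyperbolic.abs_deriv_ambientMetric_le (hH : IsClosedHyperbolic T H) {q v : E}
    (hq : q ∈ H) (hv : T q q v = 0) (e : E) :
    |-T v e e + 8 * T q q e * T q v e| ≤ 9 * √(-T q v v) * ambientMetric T q e := by
  have hT := hH.symm
  have hq1 := hH.apply_eq_one hq
  obtain ⟨α, u, hu, rfl⟩ : ∃ (α : ℝ) (u : E), T q q u = 0 ∧ e = α • q + u :=
    ⟨T q q e, e - T q q e • q, by simp [hq1], by abel⟩
  obtain ⟨h1, h2⟩ := hH.abs_cubic_le hq hu hv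
  have hA := (hH.hyperbolic q hq).neg_apply_nonneg hu
  have e1 : T v q q = 0 := by rw [hT.swap_left, hT.swap_right, hv]
  have e2 : T q v q = 0 := by rw [hT.swap_right, hv]
  have e3 : T v q u = T q v u := hT.swap_left _ _ _
  have e4 : T v u q = T q v u := by rw [hT.swap_right, e3]
  have e5 : T q u q = 0 := by rw [hT.swap_right, hu]
  simp only [ambientMetric, map_add, map_smul, add_apply, smul_apply,
    smul_eq_mul, hu, hq1, e1, e2, e3, e4, e5]
  set s := √(-T q v v)
  have hs : 0 ≤ s := Real.sqrt_nonneg _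
  obtain ⟨a, ha, hau⟩ : ∃ a : ℝ, 0 ≤ a ∧ -T q u u = a ^ 2 :=
    ⟨_, Real.sqrt_nonneg _, (Real.sq_sqrt hA).symm⟩
  rw [hau] at h2
  rw [hau, Real.sqrt_sq ha] at h1
  have h3 : |α * T q v u| ≤ s * ((α ^ 2 + a ^ 2) / 2) := by
    rw [abs_mul]
    calc |α| * |T q v u| ≤ |α| * (s * a) := by gcongr
      _ = s * (|α| * a) := by ring
      _ ≤ s * ((α ^ 2 + a ^ 2) / 2) := by
        gcongr
        nlinarith [sq_nonneg (|α| - a), sq_abs α]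
  have hR : 9 * s * (-(α * (α * 1 + 0) + (α * 0 + T q u u)) + 2 * (α * 1 + 0) ^ 2)
      = 9 * s * (α ^ 2 + a ^ 2) := by rw [← hau]; ring
  have hL : -(α * (α * 0 + T q v u) + (α * T q v u + T v u u)) +
      8 * (α * 1 + 0) * (α * 0 + T q v u) = 6 * (α * T q v u) - T v u u := by ring
  have hsα : 0 ≤ s * α ^ 2 := by positivity
  rw [abs_le] at h2 h3
  rw [hR, hL, abs_le]
  constructor <;> nlinarith [h2.1, h2.2, h3.1, h3.2]

end Cubic

/-! ### Geodesic flow of the cubic form and its completeness -/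

section CubicGeodesics
open Set

variable {E : Type*} [NormedAddCommGroup E] [NormedSpace ℝ E]
  {T : E →L[ℝ] E →L[ℝ] E →L[ℝ] ℝ} {H : Set E}

/-- The geodesic spray of the cubic form `x ↦ T x x x`. -/
noncomputable def cubicSpray (T : E →L[ℝ] E →L[ℝ] E →L[ℝ] ℝ) (z : E × E) : E × E :=
  (z.2, -(1 / 2 : ℝ) • (T z.1).inverse (T z.2 z.2)
    - (3 / 2 * T z.2 z.2 z.1 / T z.1 z.1 z.1) • z.1)

/-- The domain on which `cubicSpray` is smooth. -/
def cubicSprayDomain (T : E →L[ℝ] E →L[ℝ] E →L[ℝ] ℝ) : Set (E × E) :=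
  {z | (T z.1).IsInvertible ∧ T z.1 z.1 z.1 ≠ 0}

theorem isOpen_cubicSprayDomain [CompleteSpace E] (T : E →L[ℝ] E →L[ℝ] E →L[ℝ] ℝ) :
    IsOpen (cubicSprayDomain T) := by
  have h1 : IsOpen {A : E →L[ℝ] E →L[ℝ] ℝ | A.IsInvertible} := ContinuousLinearEquiv.isOpen
  exact (h1.preimage (by fun_prop : Continuous fun z : E × E => T z.1)).inter
    (isOpen_ne_fun (by fun_prop) continuous_const)

theorem contDiffOn_cubicSpray [CompleteSpace E] (T : E →L[ℝ] E →L[ℝ] E →L[ℝ] ℝ) :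
    ContDiffOn ℝ ∞ (cubicSpray T) (cubicSprayDomain T) := by
  intro z hz
  refine ContDiffAt.contDiffWithinAt ?_
  have hinv : ContDiffAt ℝ ∞ (fun z : E × E => (T z.1).inverse) z :=
    (hz.1.contDiffAt_map_inverse).comp z (f := fun z : E × E => T z.1) (by fun_prop)
  refine contDiffAt_snd.prodMk (ContDiffAt.sub (contDiffAt_const.smul
    (hinv.clm_apply (by fun_prop))) (ContDiffAt.smul ?_ contDiffAt_fst))
  exact ContDiffAt.div (by fun_prop) (by fun_prop) hz.2

theorem cubicSpray_reverse (z : E × E) :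
    cubicSpray T (z.1, -z.2) = (-(cubicSpray T z).1, (cubicSpray T z).2) := by
  simp [cubicSpray]

theorem apply_cubicSpray_snd {z : E × E} (hz : (T z.1).IsInvertible) (w : E) :
    T z.1 (cubicSpray T z).2 w =
      -(1 / 2) * T z.2 z.2 w - (3 / 2 * T z.2 z.2 z.1 / T z.1 z.1 z.1) * T z.1 z.1 w := by
  simp [cubicSpray, hz]

/-- If T(q,e,·) = 0, then e is tangent and null for T(q,·,·), hence zero by hyperbolicity. -/
theorem IsHyperbolicFor.isInvertible [FiniteDimensional ℝ E] {q : E} (hq : IsHyperbolicFor T q)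
    (hT : IsSymmTrilinear T) : (T q).IsInvertible := by
  have hinj : Function.Injective (T q) := (injective_iff_map_eq_zero _).2 fun e he => by
    by_contra hne
    have h1 : T q q e = 0 := by rw [hT.swap_right, he]; rfl
    have h2 := hq.2 e hne h1
    rw [he] at h2
    simp at h2
  have hfin : Module.finrank ℝ E = Module.finrank ℝ (E →L[ℝ] ℝ) := by
    rw [(LinearMap.toContinuousLinearMap (𝕜 := ℝ) (E := E) (F' := ℝ)).symm.finrank_eq]
    exact (Subspace.dual_finrank_eq).symm
  exact ⟨(LinearEquiv.ofInjectiveOfFinrankEq (T q).toLinearMap hinj hfin).toContinuousLinearEquiv,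
    by ext; rfl⟩

theorem HasDerivWithinAt.trilinear {a b c : ℝ → E} {a' b' c' : E} {s : Set ℝ} {t : ℝ}
    (ha : HasDerivWithinAt a a' s t) (hb : HasDerivWithinAt b b' s t)
    (hc : HasDerivWithinAt c c' s t) :
    HasDerivWithinAt (fun r => T (a r) (b r) (c r))
      (T a' (b t) (c t) + T (a t) b' (c t) + T (a t) (b t) c') s t := by
  have h1 : HasDerivWithinAt (fun r => T (a r)) (T a') s t :=
    HasFDerivAt.comp_hasDerivWithinAt (E := E →L[ℝ] E →L[ℝ] ℝ) (F := E) t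
      (ContinuousLinearMap.hasFDerivAt (F := E →L[ℝ] E →L[ℝ] ℝ) T) ha
  have h2 : HasDerivWithinAt (fun r => T (a r) (b r)) (T a' (b t) + T (a t) b') s t :=
    h1.clm_apply hb
  exact h2.clm_apply hc

theorem eq_of_hasDerivWithinAt_zero {f : ℝ → ℝ} {b : ℝ}
    (hf : ∀ t ∈ Icc 0 b, HasDerivWithinAt f 0 (Icc 0 b) t) {t : ℝ} (ht : t ∈ Icc 0 b) :
    f t = f 0 := by
  refine constant_of_has_deriv_right_zero (fun s hs => (hf s hs).continuousWithinAt)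
    (fun s hs => ?_) t ht
  exact (hf s (Ico_subset_Icc_self hs)).mono_of_mem_nhdsWithin (Icc_mem_nhdsGE_of_mem hs)

/-- Solutions of the spray that start tangent to `H` stay in the tangent bundle of `H`, with
constant speed. -/
theorem IsClosedHyperbolic.invariants (hH : IsClosedHyperbolic T H) {x : ℝ → E × E} {b : ℝ}
    (hx : IsForwardSolution (cubicSpray T) (cubicSprayDomain T) x b) (h0 : (x 0).1 ∈ H)
    (hv : T (x 0).1 (x 0).1 (x 0).2 = 0) {t : ℝ} (ht : t ∈ Icc 0 b) :
    (x t).1 ∈ H ∧ T (x t).1 (x t).1 (x t).2 = 0 ∧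
      T (x t).1 (x t).2 (x t).2 = T (x 0).1 (x 0).2 (x 0).2 := by
  have hT := hH.symm
  have hd1 : ∀ t ∈ Icc 0 b, HasDerivWithinAt (fun s => (x s).1) (x t).2 (Icc 0 b) t :=
    fun t ht => (hx t ht).2.fst
  have hd2 : ∀ t ∈ Icc 0 b,
      HasDerivWithinAt (fun s => (x s).2) (cubicSpray T (x t)).2 (Icc 0 b) t :=
    fun t ht => (hx t ht).2.snd
  -- The coefficient 3/2 in the spray is made for this: the derivative is 2T(x,v,v) + T(x,x,x'')
  -- with x'' contributing -(1/2 + 3/2)T(v,v,x).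
  have htan : ∀ t ∈ Icc 0 b, T (x t).1 (x t).1 (x t).2 = 0 := fun t ht => by
    rw [← hv]
    refine eq_of_hasDerivWithinAt_zero (f := fun t => T (x t).1 (x t).1 (x t).2)
      (fun t ht => ?_) ht
    refine ((hd1 t ht).trilinear (T := T) (hd1 t ht) (hd2 t ht)).congr_deriv ?_
    rw [hT.swap_right (x t).1 (x t).1, apply_cubicSpray_snd (hx t ht).1.1,
      hT.swap_left (x t).1 (x t).2, hT.swap_right (x t).2 (x t).1]
    have := (hx t ht).1.2
    field_simp
    ring
  have hone : ∀ t ∈ Icc 0 b, T (x t).1 (x t).1 (x t).1 = 1 := fun t ht => by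
    rw [← hH.apply_eq_one h0]
    refine eq_of_hasDerivWithinAt_zero (f := fun t => T (x t).1 (x t).1 (x t).1)
      (fun t ht => ?_) ht
    refine ((hd1 t ht).trilinear (T := T) (hd1 t ht) (hd1 t ht)).congr_deriv ?_
    rw [hT.swap_left (x t).2 (x t).1, hT.swap_right (x t).1 (x t).2, htan t ht]
    ring
  refine ⟨hH.mem_of_path (c := fun t => (x t).1) (fun t ht => (hd1 t ht).continuousWithinAt)
    hone h0 ht, htan t ht, ?_⟩
  -- The derivative is T(v,v,v) + 2T(x,x'',v), and 2T(x,x'',v) = -T(v,v,v) since v is tangent.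
  refine eq_of_hasDerivWithinAt_zero (f := fun t => T (x t).1 (x t).2 (x t).2)
      (fun t ht => ?_) ht
  refine ((hd1 t ht).trilinear (T := T) (hd2 t ht) (hd2 t ht)).congr_deriv ?_
  rw [hT.swap_right (x t).1 (x t).2, apply_cubicSpray_snd (hx t ht).1.1, htan t ht]
  ring

theorem IsClosedHyperbolic.ambientMetric_le (hH : IsClosedHyperbolic T H) {x : ℝ → E × E} {b : ℝ}
    (hx : IsForwardSolution (cubicSpray T) (cubicSprayDomain T) x b) (h0 : (x 0).1 ∈ H)
    (hv : T (x 0).1 (x 0).1 (x 0).2 = 0) (e : E) {t : ℝ} (ht : t ∈ Icc 0 b) :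
    ambientMetric T (x 0).1 e ≤
      Real.exp (9 * √(-T (x 0).1 (x 0).2 (x 0).2) * t) * ambientMetric T (x t).1 e := by
  have hT := hH.symm
  set k := 9 * √(-T (x 0).1 (x 0).2 (x 0).2) with hk
  set f : ℝ → ℝ := fun t => Real.exp (k * t) * ambientMetric T (x t).1 e with hf
  have hd : ∀ t ∈ Icc 0 b, HasDerivWithinAt f
      (Real.exp (k * t) * (k * ambientMetric T (x t).1 e +
        (-T (x t).2 e e + 8 * T (x t).1 (x t).1 e * T (x t).1 (x t).2 e))) (Icc 0 b) t := by
    intro t ht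
    have hd1 : HasDerivWithinAt (fun s => (x s).1) (x t).2 (Icc 0 b) t := (hx t ht).2.fst
    have hc := hasDerivWithinAt_const t (Icc 0 b) e
    have h1 := (hd1.trilinear (T := T) hc hc).neg
    have h2 := ((hd1.trilinear (T := T) hd1 hc).pow 2).const_mul 2
    have h3 := ((hasDerivAt_id t).const_mul k).exp.hasDerivWithinAt (s := Icc 0 b)
    refine (h3.mul (h1.add h2)).congr_deriv ?_
    simp only [map_zero, zero_apply, hT.swap_left (x t).2 (x t).1, id,
      ambientMetric, Pi.add_apply, Pi.neg_apply, Pi.pow_apply]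
    simp
    ring
  have hmono : MonotoneOn f (Icc 0 b) := by
    refine monotoneOn_of_deriv_nonneg (convex_Icc 0 b)
      (fun t ht => (hd t ht).continuousWithinAt)
      (fun t ht => ((hd t (interior_subset ht)).mono interior_subset).differentiableWithinAt)
      fun t ht => ?_
    have htI := interior_subset ht
    rw [((hd t htI).hasDerivAt (mem_interior_iff_mem_nhds.1 ht)).deriv]
    obtain ⟨hm, htan, hen⟩ := hH.invariants hx h0 hv htI
    have hb := hH.abs_deriv_ambientMetric_le hm htan e
    rw [hen] at hb
    have := (abs_le.1 hb).1
    exact mul_nonneg (Real.exp_pos _).le (by linarith)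
  have := hmono (⟨le_rfl, ht.1.trans ht.2⟩ : (0 : ℝ) ∈ Icc 0 b) ht ht.1
  simpa [hf] using this

theorem IsHyperbolicFor.exists_mul_sq_norm_le [FiniteDimensional ℝ E] {q : E}
    (hq : IsHyperbolicFor T q) (hT : IsSymmTrilinear T) (hq1 : T q q q = 1) :
    ∃ m > 0, ∀ e, m * ‖e‖ ^ 2 ≤ ambientMetric T q e := by
  have hne : q ≠ 0 := by rintro rfl; simp at hq1
  have : Nontrivial E := ⟨q, 0, hne⟩
  have hcont : Continuous (ambientMetric T q) := by unfold ambientMetric; fun_prop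
  obtain ⟨u, hu, hmin⟩ := (isCompact_sphere (0 : E) 1).exists_isMinOn
    (NormedSpace.sphere_nonempty.2 zero_le_one) hcont.continuousOn
  refine ⟨_, hq.ambientMetric_pos hT hq1 (e := u) (ne_zero_of_mem_unit_sphere ⟨u, hu⟩),
    fun e => ?_⟩
  rcases eq_or_ne e 0 with rfl | he
  · simp [ambientMetric]
  have hn := norm_pos_iff.2 he
  have h := hmin (show ‖e‖⁻¹ • e ∈ Metric.sphere (0 : E) 1 by
    simp [norm_smul, hn.ne'])
  simp only [mem_ofPred_eq] at h
  have hs : ambientMetric T q (‖e‖⁻¹ • e) = ambientMetric T q e / ‖e‖ ^ 2 := by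
    simp only [ambientMetric, map_smul, smul_apply, smul_eq_mul]
    field_simp
  rwa [hs, le_div_iff₀ (by positivity)] at h

variable [FiniteDimensional ℝ E]

theorem IsClosedHyperbolic.mem_cubicSprayDomain (hH : IsClosedHyperbolic T H) {z : E × E}
    (hz : z.1 ∈ H) : z ∈ cubicSprayDomain T :=
  ⟨(hH.hyperbolic _ hz).isInvertible hH.symm, (hH.hyperbolic _ hz).1.ne'⟩

/-- The growth estimate with e = x'(t), whose form at time t is the conserved A, gives m‖x'(t)‖² ≤
exp(9√A·b₁)A. Hence the velocity is at most R and the displacement at most R·b₁; intersecting with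
the closed H makes the set of positions compact. -/
theorem IsClosedHyperbolic.exists_compact (hH : IsClosedHyperbolic T H) {x₀ : E × E}
    (h0 : x₀.1 ∈ H) (hv : T x₀.1 x₀.1 x₀.2 = 0) (b₁ : ℝ) :
    ∃ K : Set (E × E), IsCompact K ∧ K ⊆ cubicSprayDomain T ∧ ∀ (x : ℝ → E × E) (b : ℝ), 0 ≤ b →
      b ≤ b₁ → x 0 = x₀ → IsForwardSolution (cubicSpray T) (cubicSprayDomain T) x b → x b ∈ K := by
  have hT := hH.symm
  obtain ⟨m, hm, hmE⟩ := (hH.hyperbolic _ h0).exists_mul_sq_norm_le hT (hH.apply_eq_one h0)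
  set A := -T x₀.1 x₀.2 x₀.2 with hA
  have hA0 : 0 ≤ A := (hH.hyperbolic _ h0).neg_apply_nonneg hv
  set R := √(Real.exp (9 * √A * b₁) * A / m) with hR
  refine ⟨(H ∩ Metric.closedBall x₀.1 (R * b₁)) ×ˢ Metric.closedBall 0 R,
    ((isCompact_closedBall _ _).inter_left hH.isClosed).prod (isCompact_closedBall _ _),
    fun z hz => hH.mem_cubicSprayDomain hz.1.1, ?_⟩
  rintro x b hb hb₁ rfl hx
  have hspeed : ∀ t ∈ Icc 0 b, ‖(x t).2‖ ≤ R := by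
    intro t ht
    obtain ⟨hmem, htan, hen⟩ := hH.invariants hx h0 hv ht
    have h1 := hH.ambientMetric_le hx h0 hv (x t).2 ht
    have h2 : ambientMetric T (x t).1 (x t).2 = A := by
      simp only [ambientMetric, htan, hen]; ring
    have h3 := (hmE (x t).2).trans h1
    rw [h2, ← hA] at h3
    refine Real.le_sqrt_of_sq_le ?_
    rw [le_div_iff₀ hm, mul_comm]
    refine h3.trans ?_
    gcongr
    exact ht.2.trans hb₁
  obtain ⟨hmem, -, -⟩ := hH.invariants hx h0 hv ⟨hb, le_rfl⟩
  refine ⟨⟨hmem, ?_⟩, by simpa using hspeed b ⟨hb, le_rfl⟩⟩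
  have := norm_image_sub_le_of_norm_deriv_le_segment' (f := fun s => (x s).1)
    (fun t ht => (hx t ht).2.fst) (fun t ht => hspeed t (Ico_subset_Icc_self ht)) b ⟨hb, le_rfl⟩
  rw [mem_closedBall_iff_norm]
  refine this.trans ?_
  rw [sub_zero]
  gcongr

/-- Through each tangent vector of `H` there is a smooth curve in `H`, defined on all of `ℝ`, that
solves the geodesic equation of the Hessian metric along `H`. -/
theorem IsClosedHyperbolic.exists_geodesic (hH : IsClosedHyperbolic T H) {p v : E} (hp : p ∈ H)
    (hv : T p p v = 0) :
    ∃ γ : ℝ → E, ContDiff ℝ ∞ γ ∧ γ 0 = p ∧ HasDerivAt γ v 0 ∧ ∀ t, γ t ∈ H ∧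
      ∀ w, T (γ t) (γ t) w = 0 →
        T (γ t) (deriv (deriv γ) t) w + 1 / 2 * T (deriv γ t) (deriv γ t) w = 0 := by
  have hglob : ∀ u : E, T p p u = 0 → ∃ x : ℝ → E × E, x 0 = (p, u) ∧
      ∀ b, IsForwardSolution (cubicSpray T) (cubicSprayDomain T) x b := fun u hu =>
    exists_global_isForwardSolution (isOpen_cubicSprayDomain T)
      ((contDiffOn_cubicSpray T).of_le (by exact_mod_cast le_top)) (hH.mem_cubicSprayDomain hp)
      (hH.exists_compact hp hu)
  obtain ⟨x, hx0, hx⟩ := hglob v hv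
  -- Negative times come from the forward solution with velocity -v, by the symmetry (x, v) ↦ (x,
  -- -v) of the spray.
  obtain ⟨y, hy0, hy⟩ := hglob (-v) (by simp [hv])
  obtain ⟨z, hz1, hz2, hz⟩ := exists_solution_of_reversible
    ((ContinuousLinearMap.fst ℝ E E).prod (-ContinuousLinearMap.snd ℝ E E))
    (fun z hz => hz) (fun z => by simp [cubicSpray_reverse]) hx hy (by simp [hx0, hy0])
  have hmem : ∀ t, (z t).1 ∈ H := fun t => by
    rcases le_total 0 t with h | h
    · rw [hz1 t h]
      exact (hH.invariants (hx t) (by rwa [hx0]) (by simpa [hx0] using hv) ⟨h, le_rfl⟩).1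
    · rw [← neg_neg t, hz2 (-t) (neg_nonneg.2 h)]
      exact (hH.invariants (hy (-t)) (by rwa [hy0]) (by simpa [hy0] using hv)
        ⟨neg_nonneg.2 h, le_rfl⟩).1
  have hd1 : ∀ t, HasDerivAt (fun s => (z s).1) (z t).2 t := fun t => (hz t).2.fst
  have hd2 : ∀ t, HasDerivAt (fun s => (z s).2) (cubicSpray T (z t)).2 t := fun t => (hz t).2.snd
  have hz0 : z 0 = (p, v) := by rw [hz1 0 le_rfl, hx0]
  refine ⟨fun t => (z t).1, contDiff_fst.comp (contDiff_of_hasDerivAt (contDiffOn_cubicSpray T) hz),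
    by simp [hz0], by simpa [hz0] using hd1 0, fun t => ⟨hmem t, fun w hw => ?_⟩⟩
  rw [show deriv (fun s => (z s).1) = fun t => (z t).2 from funext fun t => (hd1 t).deriv,
    (hd2 t).deriv, apply_cubicSpray_snd (hz t).1.1, hw]
  ring

end CubicGeodesics

/-! ### Homogeneous cubics as symmetric trilinear forms -/

section CubicPolynomial
open Set

variable {E : Type*} [NormedAddCommGroup E] [NormedSpace ℝ E]

/-- T is one sixth of the third derivative at 0. Its symmetry comes from that of second derivatives,
and its diagonal from differentiating f(tx) = t³f(x) three times in t. -/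
theorem exists_isSymmTrilinear {f : E → ℝ} (hf : ContDiff ℝ ∞ f)
    (hom : ∀ (t : ℝ) (x : E), f (t • x) = t ^ 3 * f x) :
    ∃ T : E →L[ℝ] E →L[ℝ] E →L[ℝ] ℝ, IsSymmTrilinear T ∧ ∀ x, f x = T x x x := by
  have hf1 : ContDiff ℝ ∞ (fderiv ℝ f) := hf.fderiv_right (by simp)
  have hf2 : ContDiff ℝ ∞ (fderiv ℝ (fderiv ℝ f)) := hf1.fderiv_right (by simp)
  have hd0 : ∀ y, HasFDerivAt f (fderiv ℝ f y) y := fun y =>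
    (hf.differentiable (by simp) y).hasFDerivAt
  have hd1 : ∀ y, HasFDerivAt (fderiv ℝ f) (fderiv ℝ (fderiv ℝ f) y) y := fun y =>
    (hf1.differentiable (by simp) y).hasFDerivAt
  have hd2 : ∀ y, HasFDerivAt (fderiv ℝ (fderiv ℝ f)) (fderiv ℝ (fderiv ℝ (fderiv ℝ f)) y) y :=
    fun y => (hf2.differentiable (by simp) y).hasFDerivAt
  set D3 : E →L[ℝ] E →L[ℝ] E →L[ℝ] ℝ := fderiv ℝ (fderiv ℝ (fderiv ℝ f)) 0 with hD3
  have hl : ∀ (x : E) (t : ℝ), HasDerivAt (fun s : ℝ => s • x) x t := fun x t => by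
    simpa using (hasDerivAt_id t).smul_const x
  have hd3 : ∀ x a b : E,
      HasDerivAt (fun s : ℝ => fderiv ℝ (fderiv ℝ f) (s • x) a b) (D3 x a b) 0 := fun x a b => by
    have h0 : HasDerivAt (fun s : ℝ => fderiv ℝ (fderiv ℝ f) (s • x)) (D3 x) 0 :=
      HasFDerivAt.comp_hasDerivAt (E := E →L[ℝ] E →L[ℝ] ℝ) (F := E) (0 : ℝ)
        (by rw [zero_smul]; exact hd2 0) (hl x 0)
    have h1 : HasDerivAt (fun s : ℝ => fderiv ℝ (fderiv ℝ f) (s • x) a) (D3 x a) 0 := by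
      simpa using h0.clm_apply (hasDerivAt_const (0 : ℝ) a)
    simpa using h1.clm_apply (hasDerivAt_const (0 : ℝ) b)
  refine ⟨(1 / 6 : ℝ) • D3, ⟨fun u v w => ?_, fun u v w => ?_⟩, fun x => ?_⟩
  · have := second_derivative_symmetric hd1 (hd2 0) u v
    simp only [smul_apply]
    rw [hD3, this]
  · have h2 : (fun s : ℝ => fderiv ℝ (fderiv ℝ f) (s • u) v w) =
        fun s => fderiv ℝ (fderiv ℝ f) (s • u) w v :=
      funext fun s => second_derivative_symmetric hd0 (hd1 (s • u)) v w
    simp only [smul_apply]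
    rw [(hd3 u v w).unique (h2 ▸ hd3 u w v)]
  · have e1 : ∀ t : ℝ, fderiv ℝ f (t • x) x = 3 * t ^ 2 * f x := fun t => by
      have h1 := (hd0 (t • x)).comp_hasDerivAt t (hl x t)
      have h2 : HasDerivAt (f ∘ fun s : ℝ => s • x) (3 * t ^ 2 * f x) t := by
        rw [show (f ∘ fun s : ℝ => s • x) = fun s => s ^ 3 * f x from funext fun s => hom s x]
        simpa using (hasDerivAt_pow 3 t).mul_const (f x)
      exact h1.unique h2
    have e2 : ∀ t : ℝ, fderiv ℝ (fderiv ℝ f) (t • x) x x = 6 * t * f x := fun t => by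
      have h1 : HasDerivAt (fun s : ℝ => fderiv ℝ f (s • x) x)
          (fderiv ℝ (fderiv ℝ f) (t • x) x x) t :=
        (ContinuousLinearMap.apply ℝ ℝ x).hasFDerivAt.comp_hasDerivAt t
          ((hd1 (t • x)).comp_hasDerivAt t (hl x t))
      have h2 : HasDerivAt (fun s : ℝ => fderiv ℝ f (s • x) x) (6 * t * f x) t := by
        rw [funext e1]
        refine (((hasDerivAt_pow 2 t).const_mul 3).mul_const (f x)).congr_deriv ?_
        simp only [Nat.cast_ofNat, Nat.add_one_sub_one, pow_one]; ring
      exact h1.unique h2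
    have e3 : D3 x x x = 6 * f x := by
      have h2 : HasDerivAt (fun s : ℝ => fderiv ℝ (fderiv ℝ f) (s • x) x x) (6 * f x) 0 := by
        rw [funext e2]
        simpa using ((hasDerivAt_id (0 : ℝ)).const_mul 6).mul_const (f x)
      exact (hd3 x x x).unique h2
    simp only [smul_apply, smul_eq_mul, e3]
    ring

variable {T : E →L[ℝ] E →L[ℝ] E →L[ℝ] ℝ}

theorem IsSymmTrilinear.hasFDerivAt_diag (hT : IsSymmTrilinear T) (p : E) :
    HasFDerivAt (fun x => T x x) ((2 : ℝ) • T p) p := by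
  have h0 : HasFDerivAt (fun x => T x) T p :=
    ContinuousLinearMap.hasFDerivAt (F := E →L[ℝ] E →L[ℝ] ℝ) T
  refine (h0.clm_apply (hasFDerivAt_id p)).congr_fderiv ?_
  ext v w
  simp [hT.swap_left v p]
  ring

theorem IsSymmTrilinear.hasFDerivAt_cubic (hT : IsSymmTrilinear T) (p : E) :
    HasFDerivAt (fun x => T x x x) ((3 : ℝ) • T p p) p := by
  refine ((hT.hasFDerivAt_diag p).clm_apply (hasFDerivAt_id p)).congr_fderiv ?_
  ext v
  simp [hT.swap_right p v p]
  ring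

theorem IsSymmTrilinear.fderiv_fderiv_cubic (hT : IsSymmTrilinear T) (p : E) :
    fderiv ℝ (fderiv ℝ fun x => T x x x) p = (6 : ℝ) • T p := by
  rw [show (fderiv ℝ fun x => T x x x) = fun p => (3 : ℝ) • T p p from
    funext fun p => (hT.hasFDerivAt_cubic p).fderiv, ((hT.hasFDerivAt_diag p).fun_const_smul _).fderiv,
    smul_smul]
  norm_num

end CubicPolynomial

/-! ### From the signature condition to the trilinear form -/

section PSR
open Set

variable {n : ℕ} {T : EuclideanSpace ℝ (Fin (n + 1)) →L[ℝ] EuclideanSpace ℝ (Fin (n + 1)) →L[ℝ]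
  EuclideanSpace ℝ (Fin (n + 1)) →L[ℝ] ℝ}

theorem contDiff_polyFun (h : MvPolynomial (Fin (n + 1)) ℝ) : ContDiff ℝ ∞ (polyFun h) := by
  unfold polyFun
  simp only [MvPolynomial.eval_eq']
  fun_prop

theorem polyFun_smul {h : MvPolynomial (Fin (n + 1)) ℝ} {k : ℕ} (hh : h.IsHomogeneous k) (t : ℝ)
    (x : EuclideanSpace ℝ (Fin (n + 1))) : polyFun h (t • x) = t ^ k * polyFun h x := by
  simp only [polyFun, MvPolynomial.eval_eq', Finset.mul_sum]
  refine Finset.sum_congr rfl fun d hd => ?_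
  have hk : ∑ i, d i = k := by
    rw [← hh (MvPolynomial.mem_support_iff.1 hd), Finsupp.weight_apply, Finsupp.sum_fintype]
    · simp
    · simp
  simp only [PiLp.smul_apply, smul_eq_mul, mul_pow, Finset.prod_mul_distrib,
    Finset.prod_pow_eq_pow_sum, hk]
  ring

/-- A tangent v ≠ 0 with T(p,v,v) ≥ 0 would span with p a plane on which the negative Hessian is
nonpositive, leaving room for at most n - 1 positive directions. -/
theorem IsHyperbolicPoint.isHyperbolicFor (hT : IsSymmTrilinear T)
    {p : EuclideanSpace ℝ (Fin (n + 1))} (hp : IsHyperbolicPoint (fun x => T x x x) p) :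
    IsHyperbolicFor T p := by
  refine ⟨hp.1, fun v hv hpv => ?_⟩
  by_contra hneg
  rw [not_lt] at hneg
  have h0 := hp.1
  have hli : LinearIndependent ℝ ![p, v] := by
    refine LinearIndependent.pair_iff.2 fun s t hst => ?_
    have h1 : T p p (s • p + t • v) = 0 := by rw [hst, map_zero]
    simp only [map_add, map_smul, smul_eq_mul, hpv, mul_zero, add_zero] at h1
    have hs : s = 0 := (mul_eq_zero.1 h1).resolve_right h0.ne'
    rw [hs, zero_smul, zero_add] at hst
    exact ⟨hs, (smul_eq_zero.1 hst).resolve_right hv⟩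
  have hQ : ∀ x ∈ Submodule.span ℝ (range ![p, v]), negHessian (fun x => T x x x) p x ≤ 0 := by
    intro x hx
    rw [Matrix.range_cons, Matrix.range_cons, Matrix.range_empty, union_empty,
      singleton_union, Submodule.mem_span_pair] at hx
    obtain ⟨a, b, rfl⟩ := hx
    have e : T p v p = 0 := by rw [hT.swap_right, hpv]
    simp only [negHessian, LinearMap.BilinMap.toQuadraticMap_apply, hT.fderiv_fderiv_cubic]
    simp [hpv, e]
    have := mul_nonneg (mul_self_nonneg a) h0.le
    have := mul_nonneg (mul_self_nonneg b) hneg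
    nlinarith
  have hle := QuadraticForm.sigPos_add_finrank_le_of_nonpos hQ
  rw [hp.2.1, finrank_span_eq_card hli, finrank_euclideanSpace] at hle
  simp at hle

theorem IsPSRManifold.exists_isClosedHyperbolic {H : Set (EuclideanSpace ℝ (Fin (n + 1)))}
    (hPSR : IsPSRManifold H) (hclosed : IsClosed H) :
    ∃ T : EuclideanSpace ℝ (Fin (n + 1)) →L[ℝ] EuclideanSpace ℝ (Fin (n + 1)) →L[ℝ]
      EuclideanSpace ℝ (Fin (n + 1)) →L[ℝ] ℝ, IsClosedHyperbolic T H := by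
  obtain ⟨h, hhom, -, hW, hhyp⟩ := hPSR
  obtain ⟨T, hT, hTh⟩ := exists_isSymmTrilinear (contDiff_polyFun h) (polyFun_smul hhom)
  rw [funext hTh] at hW hhyp
  exact ⟨T, hT, hclosed, hW, fun q hq => (hhyp q hq).isHyperbolicFor hT⟩

theorem IsClosedHyperbolic.apply_eq_zero_of_isTangentTo
    {H : Set (EuclideanSpace ℝ (Fin (n + 1)))} (hH : IsClosedHyperbolic T H)
    {p v : EuclideanSpace ℝ (Fin (n + 1))} (hv : IsTangentTo H p v) : T p p v = 0 := by
  obtain ⟨c, rfl, hc, hcH⟩ := hv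
  have h1 := (hH.symm.hasFDerivAt_cubic (c 0)).comp_hasDerivAt 0 hc
  have h2 : HasDerivAt ((fun x => T x x x) ∘ c) 0 0 :=
    (hasDerivAt_const 0 (1 : ℝ)).congr_of_eventuallyEq
      (hcH.mono fun t ht => hH.apply_eq_one ht)
  simpa using h1.unique h2

end PSR

/-! ### Local parametrizations and the geodesic equation in coordinates -/

section LocalGeometry
open Set

variable {n : ℕ} {H : Set (EuclideanSpace ℝ (Fin (n + 1)))}
  {T : EuclideanSpace ℝ (Fin (n + 1)) →L[ℝ] EuclideanSpace ℝ (Fin (n + 1)) →L[ℝ]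
    EuclideanSpace ℝ (Fin (n + 1)) →L[ℝ] ℝ}

theorem exists_parametrization_of_ker (l : EuclideanSpace ℝ (Fin (n + 1)) →L[ℝ] ℝ)
    {p : EuclideanSpace ℝ (Fin (n + 1))} (hp : l p = 1) :
    ∃ (L : EuclideanSpace ℝ (Fin n) →L[ℝ] EuclideanSpace ℝ (Fin (n + 1)))
      (P : EuclideanSpace ℝ (Fin (n + 1)) →L[ℝ] EuclideanSpace ℝ (Fin n)),
      (∀ y, l (L y) = 0) ∧ (∀ y, P (L y) = y) ∧ P p = 0 ∧ ∀ w, L (P w) = w - l w • p := by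
  set K := LinearMap.ker l.toLinearMap with hK
  have hne : l.toLinearMap ≠ 0 := fun h => by
    have : l p = 0 := DFunLike.congr_fun h p
    rw [hp] at this
    exact one_ne_zero this
  have hfin : Module.finrank ℝ K = n := by
    have := Module.Dual.finrank_ker_add_one_of_ne_zero (f := l.toLinearMap) hne
    rw [finrank_euclideanSpace, Fintype.card_fin] at this
    exact Nat.succ_injective this
  let e : EuclideanSpace ℝ (Fin n) ≃L[ℝ] K :=
    (LinearEquiv.ofFinrankEq _ _ (by rw [hfin]; simp)).toContinuousLinearEquiv
  let Q : EuclideanSpace ℝ (Fin (n + 1)) →L[ℝ] EuclideanSpace ℝ (Fin (n + 1)) :=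
    ContinuousLinearMap.id ℝ _ - l.smulRight p
  have hQ : ∀ w, Q w = w - l w • p := fun w => by simp [Q]
  have hQK : ∀ w, Q w ∈ K := fun w => by
    rw [hK, LinearMap.mem_ker, hQ]
    simp [hp]
  have hQe : ∀ k : K, Q.codRestrict K hQK k = k := fun k => Subtype.ext <| by
    have : l k = 0 := k.2
    simp [hQ, this]
  refine ⟨K.subtypeL.comp (e : EuclideanSpace ℝ (Fin n) →L[ℝ] K),
    (e.symm : K →L[ℝ] EuclideanSpace ℝ (Fin n)).comp (Q.codRestrict K hQK), fun y => (e y).2,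
    fun y => ?_, ?_, fun w => ?_⟩
  · simpa using congrArg e.symm (hQe (e y))
  · have : Q.codRestrict K hQK p = 0 := Subtype.ext (by simp [hQ, hp])
    simp [this]
  · simp [hQ]

/-- Each point of `H` lies in the image of a local parametrization with a smooth local inverse. -/
theorem IsClosedHyperbolic.exists_isLocalParametrization (hH : IsClosedHyperbolic T H)
    {p : EuclideanSpace ℝ (Fin (n + 1))} (hp : p ∈ H) :
    ∃ (V : Set (EuclideanSpace ℝ (Fin n)))
      (φ : EuclideanSpace ℝ (Fin n) → EuclideanSpace ℝ (Fin (n + 1)))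
      (U : Set (EuclideanSpace ℝ (Fin (n + 1))))
      (ψ : EuclideanSpace ℝ (Fin (n + 1)) → EuclideanSpace ℝ (Fin n)),
      IsLocalParametrization H V φ ∧ IsOpen U ∧ p ∈ U ∧ ContDiffOn ℝ ∞ ψ U ∧
        ∀ q ∈ U ∩ H, ψ q ∈ V ∧ φ (ψ q) = q := by
  have hp1 := hH.apply_eq_one hp
  obtain ⟨W, hWo, hW⟩ := hH.exists_isOpen
  obtain ⟨L, P, hL, hPL, hPp, hLP⟩ := exists_parametrization_of_ker (T p p) hp1
  set f : EuclideanSpace ℝ (Fin n) → ℝ := fun y => T (p + L y) (p + L y) (p + L y) with hf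
  have hfs : ContDiff ℝ ∞ f := by
    rw [hf]; fun_prop
  have hV₀ : IsOpen {y | 0 < f y} := isOpen_lt continuous_const hfs.continuous
  -- Radial projection of the affine tangent plane p + ker T(p,p,·) to the level set.
  set φ : EuclideanSpace ℝ (Fin n) → EuclideanSpace ℝ (Fin (n + 1)) :=
    fun y => (f y ^ (-(1 / 3) : ℝ)) • (p + L y) with hφ
  have hφs : ContDiffOn ℝ ∞ φ {y | 0 < f y} := by
    refine ContDiffOn.smul (hfs.contDiffOn.rpow_const_of_ne fun y hy => ne_of_gt hy) ?_
    fun_prop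
  set V := {y | 0 < f y} ∩ φ ⁻¹' W with hVdef
  have hV : IsOpen V := hφs.continuousOn.isOpen_inter_preimage hV₀ hWo
  have hφV : ContDiffOn ℝ ∞ φ V := hφs.mono inter_subset_left
  -- The inverse: scale q back to the plane T(p,p,·) = 1, then read off coordinates.
  set ψ : EuclideanSpace ℝ (Fin (n + 1)) → EuclideanSpace ℝ (Fin n) :=
    fun q => P ((T p p q)⁻¹ • q) with hψ
  have hψs : ContDiffOn ℝ ∞ ψ {q | 0 < T p p q} := by
    have h : ContDiffOn ℝ ∞ (fun q => (T p p q)⁻¹ • q) {q | 0 < T p p q} :=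
      ContDiffOn.smul ((T p p).contDiff.contDiffOn.inv fun q hq => ne_of_gt hq) contDiffOn_id
    exact P.contDiff.comp_contDiffOn h
  have hU₀ : IsOpen {q | 0 < T p p q} := isOpen_lt continuous_const (T p p).continuous
  have hTφ : ∀ y, T p p (φ y) = f y ^ (-(1 / 3) : ℝ) := fun y => by
    simp [hφ, hp1, hL]
  have hψφ : ∀ y, 0 < f y → ψ (φ y) = y := fun y hy => by
    have hr := Real.rpow_pos_of_pos hy (-(1 / 3))
    simp only [hψ, hTφ]
    simp only [hφ]
    rw [smul_smul, inv_mul_cancel₀ hr.ne', one_smul, map_add, hPp, hPL, zero_add]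
  have hφ0 : φ 0 = p := by simp [hφ, hf, hp1]
  have h0V : (0 : EuclideanSpace ℝ (Fin n)) ∈ V := by
    refine ⟨by simp [hf, hp1], ?_⟩
    rw [mem_preimage, hφ0]
    exact (hW ▸ hp : p ∈ W ∩ _).1
  have hψp : ψ p = 0 := by simp [hψ, hp1, hPp]
  refine ⟨V, φ, {q | 0 < T p p q} ∩ ψ ⁻¹' V, ψ, ⟨hV, hφV, fun y hy => ?_, fun y hy => ?_⟩,
    hψs.continuousOn.isOpen_inter_preimage hU₀ hV, ⟨by simp [hp1], by rwa [mem_preimage, hψp]⟩,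
    hψs.mono inter_subset_left, fun q hq => ⟨hq.1.2, ?_⟩⟩
  · have hdφ := ((hφV.contDiffAt (hV.mem_nhds hy)).differentiableAt (by simp)).hasFDerivAt
    have hdψ := ((hψs.contDiffAt (hU₀.mem_nhds (show 0 < T p p (φ y) by
      rw [hTφ]; exact Real.rpow_pos_of_pos hy.1 _))).differentiableAt (by simp)).hasFDerivAt
    have hid : HasFDerivAt (ψ ∘ φ) (ContinuousLinearMap.id ℝ _) y :=
      (hasFDerivAt_id y).congr_of_eventuallyEq (by
        filter_upwards [hV₀.mem_nhds hy.1] with z hz using hψφ z hz)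
    have := (hdψ.comp y hdφ).unique hid
    exact Function.LeftInverse.injective (g := fderiv ℝ ψ (φ y)) fun u => DFunLike.congr_fun this u
  · rw [hW]
    refine ⟨hy.2, ?_⟩
    have hf0 : 0 < f y := hy.1
    have h3 : (f y ^ (-(1 / 3) : ℝ)) ^ 3 * f y = 1 := by
      rw [← Real.rpow_natCast, ← Real.rpow_mul hf0.le]
      norm_num
      rw [Real.rpow_neg_one, inv_mul_cancel₀ hf0.ne']
    simp only [mem_ofPred_eq, hφ, map_smul, smul_apply, smul_eq_mul]
    rw [show T (p + L y) (p + L y) (p + L y) = f y from rfl]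
    linear_combination h3
  · obtain ⟨⟨hq0, hqV⟩, hqH⟩ := hq
    have hq0 : 0 < T p p q := hq0
    have hq1 := hH.apply_eq_one hqH
    have hline : p + L (ψ q) = (T p p q)⁻¹ • q := by
      simp only [hψ, hLP, map_smul]
      rw [smul_sub, smul_smul, inv_mul_cancel₀ hq0.ne', one_smul]
      abel
    have hfq : f (ψ q) = ((T p p q) ^ 3)⁻¹ := by
      simp only [hf, hline, map_smul, smul_apply, smul_eq_mul, hq1]
      field_simp
    have hr : f (ψ q) ^ (-(1 / 3) : ℝ) = T p p q := by
      rw [hfq, Real.inv_rpow (by positivity), ← Real.rpow_neg (by positivity),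
        ← Real.rpow_natCast, ← Real.rpow_mul hq0.le]
      norm_num
    simp only [hφ, hr, hline]
    rw [smul_smul, mul_inv_cancel₀ hq0.ne', one_smul]

variable {V : Set (EuclideanSpace ℝ (Fin n))}
  {φ : EuclideanSpace ℝ (Fin n) → EuclideanSpace ℝ (Fin (n + 1))}

theorem IsLocalParametrization.hasFDerivAt (hφ : IsLocalParametrization H V φ)
    {y : EuclideanSpace ℝ (Fin n)} (hy : y ∈ V) : HasFDerivAt φ (fderiv ℝ φ y) y :=
  ((hφ.smooth.contDiffAt (hφ.isOpen.mem_nhds hy)).differentiableAt (by simp)).hasFDerivAt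

theorem IsLocalParametrization.hasFDerivAt_fderiv (hφ : IsLocalParametrization H V φ)
    {y : EuclideanSpace ℝ (Fin n)} (hy : y ∈ V) :
    HasFDerivAt (fderiv ℝ φ) (fderiv ℝ (fderiv ℝ φ) y) y :=
  (((hφ.smooth.contDiffAt (hφ.isOpen.mem_nhds hy)).fderiv_right (m := ∞)
    (by simp)).differentiableAt (by simp)).hasFDerivAt

theorem IsLocalParametrization.hasFDerivAt_fderiv_apply (hφ : IsLocalParametrization H V φ)
    {y : EuclideanSpace ℝ (Fin n)} (hy : y ∈ V) (v : EuclideanSpace ℝ (Fin n)) :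
    HasFDerivAt (fun z => fderiv ℝ φ z v) ((fderiv ℝ (fderiv ℝ φ) y).flip v) y := by
  refine ((hφ.hasFDerivAt_fderiv hy).clm_apply (hasFDerivAt_const v y)).congr_fderiv ?_
  ext u
  simp

theorem IsLocalParametrization.fderiv_fderiv_symm (hφ : IsLocalParametrization H V φ)
    {y : EuclideanSpace ℝ (Fin n)} (hy : y ∈ V) (u v : EuclideanSpace ℝ (Fin n)) :
    fderiv ℝ (fderiv ℝ φ) y u v = fderiv ℝ (fderiv ℝ φ) y v u :=
  second_derivative_symmetric_of_eventually
    (by filter_upwards [hφ.isOpen.mem_nhds hy] with z hz using hφ.hasFDerivAt hz)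
    (hφ.hasFDerivAt_fderiv hy) u v

theorem HasFDerivAt.trilinear {F E : Type*} [NormedAddCommGroup F] [NormedSpace ℝ F]
    [NormedAddCommGroup E] [NormedSpace ℝ E] {S : E →L[ℝ] E →L[ℝ] E →L[ℝ] ℝ} {a b c : F → E}
    {a' b' c' : F →L[ℝ] E} {y : F} (ha : HasFDerivAt a a' y) (hb : HasFDerivAt b b' y)
    (hc : HasFDerivAt c c' y) :
    ∃ D : F →L[ℝ] ℝ, HasFDerivAt (fun z => S (a z) (b z) (c z)) D y ∧
      ∀ u, D u = S (a' u) (b y) (c y) + S (a y) (b' u) (c y) + S (a y) (b y) (c' u) := by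
  have h0 : HasFDerivAt (fun x => S x) S (a y) :=
    ContinuousLinearMap.hasFDerivAt (F := E →L[ℝ] E →L[ℝ] ℝ) S
  have h1 : HasFDerivAt (fun z => S (a z)) (S.comp a') y :=
    HasFDerivAt.comp (F := E) (G := E →L[ℝ] E →L[ℝ] ℝ) y h0 ha
  refine ⟨_, (h1.clm_apply hb).clm_apply hc, fun u => ?_⟩
  simp
  ring

theorem IsLocalParametrization.apply_fderiv_eq_zero (hH : IsClosedHyperbolic T H)
    (hφ : IsLocalParametrization H V φ) {y : EuclideanSpace ℝ (Fin n)} (hy : y ∈ V)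
    (u : EuclideanSpace ℝ (Fin n)) : T (φ y) (φ y) (fderiv ℝ φ y u) = 0 := by
  have h1 := (hH.symm.hasFDerivAt_cubic (φ y)).comp y (hφ.hasFDerivAt hy)
  have h2 : HasFDerivAt ((fun x => T x x x) ∘ φ) (0 : EuclideanSpace ℝ (Fin n) →L[ℝ] ℝ) y :=
    (hasFDerivAt_const (1 : ℝ) y).congr_of_eventuallyEq (by
      filter_upwards [hφ.isOpen.mem_nhds hy] with z hz using hH.apply_eq_one (hφ.mapsTo hz))
  simpa using DFunLike.congr_fun (h1.unique h2) u

/-- Differentiating the tangency relation T(φ,φ,dφ v) = 0 in direction u. -/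
theorem IsLocalParametrization.apply_fderiv_fderiv (hH : IsClosedHyperbolic T H)
    (hφ : IsLocalParametrization H V φ) {y : EuclideanSpace ℝ (Fin n)} (hy : y ∈ V)
    (u v : EuclideanSpace ℝ (Fin n)) :
    T (φ y) (φ y) (fderiv ℝ (fderiv ℝ φ) y u v) =
      -2 * T (φ y) (fderiv ℝ φ y u) (fderiv ℝ φ y v) := by
  obtain ⟨D, hD, hDu⟩ := HasFDerivAt.trilinear (S := T) (hφ.hasFDerivAt hy) (hφ.hasFDerivAt hy)
    (hφ.hasFDerivAt_fderiv_apply hy v)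
  have h2 : HasFDerivAt (fun z => T (φ z) (φ z) (fderiv ℝ φ z v))
      (0 : EuclideanSpace ℝ (Fin n) →L[ℝ] ℝ) y :=
    (hasFDerivAt_const (0 : ℝ) y).congr_of_eventuallyEq (by
      filter_upwards [hφ.isOpen.mem_nhds hy] with z hz using hφ.apply_fderiv_eq_zero hH hz v)
  have h := hDu u
  rw [hD.unique h2, hH.symm.swap_left (fderiv ℝ φ y u)] at h
  simp only [zero_apply, ContinuousLinearMap.flip_apply] at h
  linarith

/-- The centro-affine fundamental form in terms of the cubic form. -/
theorem IsLocalParametrization.centroAffineForm_eq (hH : IsClosedHyperbolic T H)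
    (hφ : IsLocalParametrization H V φ) {y : EuclideanSpace ℝ (Fin n)} (hy : y ∈ V)
    (u v : EuclideanSpace ℝ (Fin n)) :
    centroAffineForm φ y u v = -2 * T (φ y) (fderiv ℝ φ y u) (fderiv ℝ φ y v) := by
  have h1 : T (φ y) (φ y) (φ y) = 1 := hH.apply_eq_one (hφ.mapsTo hy)
  have hne : φ y ≠ 0 := fun h => by simp [h] at h1
  have hcompl : IsCompl (LinearMap.range (fderiv ℝ φ y).toLinearMap)
      (Submodule.span ℝ {φ y}) := by
    have hdisj : Disjoint (LinearMap.range (fderiv ℝ φ y).toLinearMap)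
        (Submodule.span ℝ {φ y}) := by
      rw [Submodule.disjoint_def]
      rintro _ ⟨w, rfl⟩ hw
      obtain ⟨c, hc⟩ := Submodule.mem_span_singleton.1 hw
      have h0 := hφ.apply_fderiv_eq_zero hH hy w
      rw [ContinuousLinearMap.coe_coe] at hc ⊢
      rw [← hc] at h0 ⊢
      rw [map_smul, h1, smul_eq_mul, mul_one] at h0
      rw [h0, zero_smul]
    refine (Submodule.isCompl_iff_disjoint _ _ ?_).2 hdisj
    rw [finrank_span_singleton hne, LinearMap.finrank_range_of_inj (hφ.immersion y hy)]
    simp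
  -- T(φ,φ,·) kills the tangential part of the Gauss equation and is 1 on the position vector, so it
  -- extracts the coefficient.
  obtain ⟨w, hw⟩ := (centroAffineForm_eq_iff φ y u v hne hcompl _).1 rfl
  have h := hφ.apply_fderiv_fderiv hH hy u v
  rw [hw, map_add, hφ.apply_fderiv_eq_zero hH hy, map_smul, h1] at h
  simpa using h

theorem IsLocalParametrization.fderiv_centroAffineForm (hH : IsClosedHyperbolic T H)
    (hφ : IsLocalParametrization H V φ) {y : EuclideanSpace ℝ (Fin n)} (hy : y ∈ V)
    (u v w : EuclideanSpace ℝ (Fin n)) :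
    fderiv ℝ (fun z => centroAffineForm φ z v w) y u =
      -2 * (T (fderiv ℝ φ y u) (fderiv ℝ φ y v) (fderiv ℝ φ y w)
        + T (φ y) (fderiv ℝ (fderiv ℝ φ) y u v) (fderiv ℝ φ y w)
        + T (φ y) (fderiv ℝ φ y v) (fderiv ℝ (fderiv ℝ φ) y u w)) := by
  obtain ⟨D, hD, hDu⟩ := HasFDerivAt.trilinear (S := T) (hφ.hasFDerivAt hy)
    (hφ.hasFDerivAt_fderiv_apply hy v) (hφ.hasFDerivAt_fderiv_apply hy w)
  have h := (hD.const_mul (-2)).congr_of_eventuallyEq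
    (f₁ := fun z => centroAffineForm φ z v w) (by
      filter_upwards [hφ.isOpen.mem_nhds hy] with z hz using hφ.centroAffineForm_eq hH hz v w)
  rw [h.fderiv, smul_apply, hDu]
  rfl

/-- The terms with the mixed second derivative D²φ(u,w) cancel, and the three derivatives of T's
base point leave -T(u,u,w). -/
theorem IsLocalParametrization.christoffelFirst_eq (hH : IsClosedHyperbolic T H)
    (hφ : IsLocalParametrization H V φ) {y : EuclideanSpace ℝ (Fin n)} (hy : y ∈ V)
    (u w : EuclideanSpace ℝ (Fin n)) :
    christoffelFirst (centroAffineForm φ) y u u w =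
      -2 * T (φ y) (fderiv ℝ (fderiv ℝ φ) y u u) (fderiv ℝ φ y w)
        - T (fderiv ℝ φ y u) (fderiv ℝ φ y u) (fderiv ℝ φ y w) := by
  have hT := hH.symm
  simp only [christoffelFirst, hφ.fderiv_centroAffineForm hH hy]
  rw [hφ.fderiv_fderiv_symm hy w u, hT.swap_left (fderiv ℝ φ y w) (fderiv ℝ φ y u),
    hT.swap_right (fderiv ℝ φ y u) (fderiv ℝ φ y w),
    hT.swap_right (φ y) (fderiv ℝ (fderiv ℝ φ) y u w)]
  ring

/-- A smooth curve in `H` that solves the geodesic equation of the Hessian metric along `H` is a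
geodesic of the centro-affine fundamental form. -/
theorem IsClosedHyperbolic.isCentroAffineGeodesic (hH : IsClosedHyperbolic T H)
    {γ : ℝ → EuclideanSpace ℝ (Fin (n + 1))} (hγ : ContDiff ℝ ∞ γ)
    (hgeo : ∀ t, γ t ∈ H ∧ ∀ w, T (γ t) (γ t) w = 0 →
      T (γ t) (deriv (deriv γ) t) w + 1 / 2 * T (deriv γ t) (deriv γ t) w = 0) :
    IsCentroAffineGeodesic H γ := by
  intro t₀
  obtain ⟨V, φ, U, ψ, hφ, hU, hpU, hψ, hφψ⟩ := hH.exists_isLocalParametrization (hgeo t₀).1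
  obtain ⟨ε, hε, hball⟩ := Metric.isOpen_iff.1 (hU.preimage hγ.continuous) t₀ hpU
  rw [Real.ball_eq_Ioo] at hball
  have hx : ContDiffOn ℝ ∞ (ψ ∘ γ) (Ioo (t₀ - ε) (t₀ + ε)) :=
    hψ.comp hγ.contDiffOn hball
  refine ⟨V, φ, hφ, ε, ψ ∘ γ, hε, hx, fun t ht => ?_⟩
  set x := ψ ∘ γ with hxdef
  have hmem : ∀ s ∈ Ioo (t₀ - ε) (t₀ + ε), x s ∈ V ∧ φ (x s) = γ s := fun s hs =>
    hφψ (γ s) ⟨hball hs, (hgeo s).1⟩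
  have hnhds : ∀ s ∈ Ioo (t₀ - ε) (t₀ + ε), Ioo (t₀ - ε) (t₀ + ε) ∈ 𝓝 s := fun s hs =>
    isOpen_Ioo.mem_nhds hs
  have hx1 : ∀ s ∈ Ioo (t₀ - ε) (t₀ + ε), HasDerivAt x (deriv x s) s := fun s hs =>
    ((hx.contDiffAt (hnhds s hs)).differentiableAt (by simp)).hasDerivAt
  have hx2 : HasDerivAt (deriv x) (deriv (deriv x) t) t :=
    (((hx.deriv_of_isOpen (m := ∞) isOpen_Ioo (by simp)).contDiffAt
      (hnhds t ht)).differentiableAt (by simp)).hasDerivAt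
  have hγ1 : ∀ s ∈ Ioo (t₀ - ε) (t₀ + ε), deriv γ s = fderiv ℝ φ (x s) (deriv x s) :=
    fun s hs => by
      have h := (hφ.hasFDerivAt (hmem s hs).1).comp_hasDerivAt s (hx1 s hs)
      refine (h.congr_of_eventuallyEq ?_).deriv
      filter_upwards [hnhds s hs] with r hr using (hmem r hr).2.symm
  have hγ2 : deriv (deriv γ) t = fderiv ℝ (fderiv ℝ φ) (x t) (deriv x t) (deriv x t)
      + fderiv ℝ φ (x t) (deriv (deriv x) t) := by
    have h := ((hφ.hasFDerivAt_fderiv (hmem t ht).1).comp_hasDerivAt t (hx1 t ht)).clm_apply hx2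
    refine (h.congr_of_eventuallyEq ?_).deriv
    filter_upwards [hnhds t ht] with r hr using hγ1 r hr
  obtain ⟨hxV, hxγ⟩ := hmem t ht
  refine ⟨hxV, hxγ.symm, fun w => ?_⟩
  -- The coordinate geodesic equation is -2 times this relation, once γ'' is expanded by the chain
  -- rule.
  have h := (hgeo t).2 (fderiv ℝ φ (x t) w) (by
    rw [← hxγ]; exact hφ.apply_fderiv_eq_zero hH hxV w)
  rw [hγ2, hγ1 t ht, ← hxγ, map_add, add_apply] at h
  rw [hφ.centroAffineForm_eq hH hxV, hφ.christoffelFirst_eq hH hxV]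
  linarith

end LocalGeometry

theorem mainTheorem6 (n : ℕ) (H : Set (EuclideanSpace ℝ (Fin (n + 1))))
    (hPSR : IsPSRManifold H) (hclosed : IsClosed H) :
    IsGeodesicallyComplete H := by
  obtain ⟨T, hH⟩ := hPSR.exists_isClosedHyperbolic hclosed
  intro p hp v hv
  obtain ⟨γ, hγ, h0, hd, hgeo⟩ := hH.exists_geodesic hp (hH.apply_eq_zero_of_isTangentTo hv)
  exact ⟨γ, hH.isCentroAffineGeodesic hγ hgeo, h0, hd⟩
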